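/- Let $d\ge 1$ and $k\ge 2$ be integers and let $s>0$ be real. For $N\ge 0$ write $\mathrm{x}=(\mathbf x_1,\dots,\mathbf x_N)\in(\mathbb R^d)^N=\mathbb R^{dN}$, and let $$\triangle_k=\{\mathrm{x}\in(\mathbb R^d)^N:\ \mathbf x_{j_1}=\dots=\mathbf x_{j_k}\text{ for some distinct indices } j_1,\dots,j_k\}.$$ Let $\mathcal H^{s,N}_k(\mathbb R^d)$ be the closure of $\{\Psi\in C_c^\infty(\mathbb R^{dN};\mathbb C):\ \Psi|_{\triangle_k}=0\}$ in $H^s(\mathbb R^{dN})$, whose norm is $\|u\|_{H^s}^2=\|u\|_{L^2}^2+\int|\mathbf p|^{2s}|\widehat u(\mathbf p)|^2\,d\mathbf p$. Write $s=m+\sigma$ with $m\in\mathbb N_0$ and $0\le\sigma<1$. For $\Omega\subset\mathbb R^d$ put $$\|u\|_{\dot H^s(\Omega)}^2=\begin{cases}\displaystyle\sum_{|\alpha|=m}\frac{m!}{\alpha!}\int_\Omega|D^\alpha u|^2, & \sigma=0,\\[2mm] \displaystyle c_{d,\sigma}\sum_{|\alpha|=m}\frac{m!}{\alpha!}\iint_{\Omega\times\Omega}\frac{|D^\alpha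 u(\mathbf x)-D^\alpha u(\mathbf y)|^2}{|\mathbf x-\mathbf y|^{d+2\sigma}}\,d\mathbf x\,d\mathbf y, & 0<\sigma<1,\end{cases}$$ where $c_{d,\sigma}=\dfrac{2^{2\sigma-1}}{\pi^{d/2}}\dfrac{\Gamma((d+2\sigma)/2)}{|\Gamma(-\sigma)|}$ and $D^\alpha u$ is the weak derivative. For $\Psi\in H^s(\mathbb R^{dN})$ put $$\|\Psi\|_{\dot H^{s,N}(\Omega)}^2=\sum_{j=1}^N\int_{\Omega^{N-1}}\|\Psi\|_{\dot H^s_{\mathbf x_j}(\Omega)}^2\prod_{\ell\ne j}d\mathbf x_\ell,\qquad \mathcal E_\Omega[\Psi]=\sum_{j=1}^N\int_{\mathbb R^{d(N-1)}}\|\Psi\|_{\dot H^s_{\mathbf x_j}(\Omega)}^2\prod_{\ell\ne j}d\mathbf x_\ell,$$ $$\varrho_\Psi(\mathbf x)=\sum_{j=1}^N\int_{\mathbb R^{d(N-1)}}|\Psi(\mathbf x_1,\dots,\mathbf x_{j-1},\mathbf x,\mathbf x_{j+1},\dots,\mathbf x_N)|^2\prod_{\ell\neq j}d\mathbf x_\ell,$$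 $$E_N(\Omega)=\inf\bigl\{\|\Psi\|_{\dot H^{s,N}(\Omega)}^2:\ \Psi\in\mathcal H^{s,N}_k(\mathbb R^d),\ \|\Psi\|_{L^2(\Omega^N)}=1\bigr\}.$$ Assume that there is a real constant $q>0$ such that $E_N(Q)>0$ for every (axis-parallel) cube $Q\subset\mathbb R^d$ and every integer $N\ge q$. Then there is a constant $C>0$, depending only on $d,s,k,q$ and in particular independent of $N$, $\Psi_N$ and $Q$, such that for all $N\ge1$, all $\Psi_N\in\mathcal H^{s,N}_k(\mathbb R^d)$ with $\|\Psi_N\|_{L^2(\mathbb R^{dN})}=1$ and all cubes $Q\subset\mathbb R^d$, $$\mathcal E_Q[\Psi_N]\ \ge\ C\,|Q|^{-2s/d}\Bigl[\int_Q\varrho_{\Psi_N}(\mathbf x)\,d\mathbf x-q\Bigr]_+ ,\qquad [t]_+=\max\{t,0\}.$$ -/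

import Mathlib

open MeasureTheory FourierTransform
open scoped ENNReal ContDiff

noncomputable section

namespace ManyBody

/-! ### One- and many-particle configuration spaces -/

/-- The one-particle space `ℝ^d` with its Euclidean structure. -/
abbrev Pos (d : ℕ) : Type := EuclideanSpace ℝ (Fin d)

/-- The configuration space `(ℝ^d)^ι ≃ ℝ^{d|ι|}` of particles labelled by `ι` (for `N` particles,
`ι = Fin N`), with its Euclidean structure and Lebesgue measure. -/
abbrev Config (d : ℕ) (ι : Type*) [Fintype ι] : Type _ := PiLp 2 (fun _ : ι => Pos d)

/-- `L²((ℝ^d)^ι; ℂ)`. -/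
abbrev WaveFn (d : ℕ) (ι : Type*) [Fintype ι] : Type _ :=
  Lp ℂ 2 (volume : Measure (Config d ι))

/-- The configuration in which particle `j` sits at `y` and the other particles at `x'`. -/
def insertAt {d : ℕ} {ι : Type*} [Fintype ι] [DecidableEq ι] (j : ι) (y : Pos d)
    (x' : {l : ι // l ≠ j} → Pos d) : Config d ι :=
  WithLp.toLp 2 (fun l => if h : l = j then y else x' ⟨l, h⟩)

/-- The axis-parallel cubes `a + [0, ℓ]^d` of positive side length; any part of the boundary may
be missing. -/
def IsCube {d : ℕ} (Q : Set (Pos d)) : Prop :=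
  ∃ (a : Pos d) (l : ℝ), 0 < l ∧
    {x : Pos d | ∀ i, a i < x i ∧ x i < a i + l} ⊆ Q ∧
    Q ⊆ {x : Pos d | ∀ i, a i ≤ x i ∧ x i ≤ a i + l}

/-! ### The Sobolev space `H^s` of the full space -/

/-- `⟨u, (-Δ)^s u⟩ = ∫ |p|^{2s} |û(p)|² dp`. With the Fourier transform
`𝓕 u (ξ) = ∫ u(x) e^{-2πi ξ·x} dx` of the library the momentum is `p = 2π ξ`. -/
def homSobolevSq {V : Type*} [NormedAddCommGroup V] [InnerProductSpace ℝ V]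
    [FiniteDimensional ℝ V] [MeasurableSpace V] [BorelSpace V]
    (s : ℝ) (u : Lp ℂ 2 (volume : Measure V)) : ℝ≥0∞ :=
  ∫⁻ ξ : V, ENNReal.ofReal ((2 * Real.pi * ‖ξ‖) ^ (2 * s)) * ‖(𝓕 u : Lp ℂ 2 volume) ξ‖ₑ ^ 2

/-- The squared norm `‖u‖²_{L²} + ⟨u, (-Δ)^s u⟩` of `H^s` (infinite if `u ∉ H^s`). -/
def sobolevSq {V : Type*} [NormedAddCommGroup V] [InnerProductSpace ℝ V]
    [FiniteDimensional ℝ V] [MeasurableSpace V] [BorelSpace V]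
    (s : ℝ) (u : Lp ℂ 2 (volume : Measure V)) : ℝ≥0∞ :=
  ‖u‖ₑ ^ 2 + homSobolevSq s u

/-! ### Functions vanishing on the `k`-particle diagonals -/

/-- Configurations in which `k` distinct particles share one position. -/
def diagonal (d : ℕ) (ι : Type*) [Fintype ι] (k : ℕ) : Set (Config d ι) :=
  {x | ∃ j : Fin k ↪ ι, ∀ a b : Fin k, x (j a) = x (j b)}

/-- The (classes of) functions in `C_c^∞((ℝ^d)^ι)` that vanish on the `k`-particle diagonals. -/
def vanishingTest (d : ℕ) (ι : Type*) [Fintype ι] (k : ℕ) : Set (WaveFn d ι) :=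
  {Φ | ∃ φ : Config d ι → ℂ, ContDiff ℝ ∞ φ ∧ HasCompactSupport φ ∧
    (∀ x ∈ diagonal d ι k, φ x = 0) ∧ Φ =ᵐ[volume] φ}

/-- The closure in `H^s` of the test functions vanishing on the `k`-particle diagonals. -/
def vanishingSpace (d : ℕ) (ι : Type*) [Fintype ι] (s : ℝ) (k : ℕ) : Set (WaveFn d ι) :=
  {Ψ | sobolevSq s Ψ < ⊤ ∧
    ∀ ε : ℝ≥0∞, 0 < ε → ∃ Φ ∈ vanishingTest d ι k, sobolevSq s (Ψ - Φ) < ε}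

/-! ### The Neumann-localized fractional Laplacian on a subset of `ℝ^d` -/

/-- The partial derivative in the `i`-th coordinate direction. -/
def partialDeriv {d : ℕ} (i : Fin d) (f : Pos d → ℂ) : Pos d → ℂ :=
  fun x => fderiv ℝ f x (EuclideanSpace.single i 1)

/-- `D^α f` for a multi-index `α`. -/
def multiDeriv {d : ℕ} (α : Fin d → ℕ) (f : Pos d → ℂ) : Pos d → ℂ :=
  (List.finRange d).foldr (fun i g => (partialDeriv i)^[α i] g) f

/-- `g` is the weak derivative `D^α u` on `ℝ^d`. -/
def IsWeakDeriv {d : ℕ} (α : Fin d → ℕ) (u g : Pos d → ℂ) : Prop :=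
  LocallyIntegrable u volume ∧ LocallyIntegrable g volume ∧
    ∀ φ : Pos d → ℂ, ContDiff ℝ ∞ φ → HasCompactSupport φ →
      ∫ x, u x * multiDeriv α φ x = (-1) ^ (∑ i, α i) * ∫ x, g x * φ x

/-- The constant `c_{d,σ} = 2^{2σ-1} π^{-d/2} Γ((d+2σ)/2) / |Γ(-σ)|`. -/
def fracConst (d : ℕ) (σ : ℝ) : ℝ :=
  2 ^ (2 * σ - 1) / Real.pi ^ ((d : ℝ) / 2) *
    (Real.Gamma (((d : ℝ) + 2 * σ) / 2) / |Real.Gamma (-σ)|)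

/-- `∫_Ω |g|²` for `σ = 0`, and
`c_{d,σ} ∬_{Ω×Ω} |g(x) - g(y)|² / |x - y|^{d+2σ} dx dy` for `0 < σ < 1`. -/
def fracEnergy {d : ℕ} (σ : ℝ) (Ω : Set (Pos d)) (g : Pos d → ℂ) : ℝ≥0∞ :=
  if σ = 0 then ∫⁻ x in Ω, ‖g x‖ₑ ^ 2
  else ENNReal.ofReal (fracConst d σ) *
    ∫⁻ x in Ω, ∫⁻ y in Ω, ‖g x - g y‖ₑ ^ 2 / ‖x - y‖ₑ ^ ((d : ℝ) + 2 * σ)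

/-- The squared seminorm `‖u‖²_{Ḣ^s(Ω)} = ⟨u, (-Δ)^s_{|Ω} u⟩`: with `s = m + σ`, `m = ⌊s⌋`, it is
`∑_{|α| = m} m!/α!` times the energy of order `σ` on `Ω` of the weak derivative `D^α u`. As the
weak derivative is unique almost everywhere, the infimum only selects it (and gives `∞` if it
does not exist). -/
def neumannSq {d : ℕ} (s : ℝ) (Ω : Set (Pos d)) (u : Pos d → ℂ) : ℝ≥0∞ :=
  ∑ α ∈ Finset.piAntidiag (Finset.univ : Finset (Fin d)) ⌊s⌋₊,
    (Nat.multinomial Finset.univ α : ℝ≥0∞) *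
      ⨅ (g : Pos d → ℂ) (_ : IsWeakDeriv α u g), fracEnergy (s - ⌊s⌋₊) Ω g

/-! ### Many-particle energies and density -/

/-- The expected local energy
`∑_j ∫_{(ℝ^d)^{N-1}} ‖Ψ‖²_{Ḣ^s_{x_j}(Ω)} ∏_{l ≠ j} dx_l` of `Ψ` on `Ω`. -/
def localEnergy {d : ℕ} {ι : Type*} [Fintype ι] [DecidableEq ι]
    (s : ℝ) (Ω : Set (Pos d)) (Ψ : Config d ι → ℂ) : ℝ≥0∞ :=
  ∑ j : ι, ∫⁻ x' : {l : ι // l ≠ j} → Pos d, neumannSq s Ω (fun y => Ψ (insertAt j y x'))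

/-- The completely localized kinetic energy
`∑_j ∫_{Ω^{N-1}} ‖Ψ‖²_{Ḣ^s_{x_j}(Ω)} ∏_{l ≠ j} dx_l`. -/
def fullyLocalEnergy {d : ℕ} {ι : Type*} [Fintype ι] [DecidableEq ι]
    (s : ℝ) (Ω : Set (Pos d)) (Ψ : Config d ι → ℂ) : ℝ≥0∞ :=
  ∑ j : ι, ∫⁻ x' in {x' : {l : ι // l ≠ j} → Pos d | ∀ l, x' l ∈ Ω},
    neumannSq s Ω (fun y => Ψ (insertAt j y x'))

/-- The `N`-particle local ground-state energy: the infimum of the completely localized kinetic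
energy over the `Ψ` in the closed space of functions vanishing on the `k`-particle diagonals with
`‖Ψ‖_{L²(Ω^N)} = 1`. -/
def groundEnergy {d : ℕ} (s : ℝ) (k N : ℕ) (Ω : Set (Pos d)) : ℝ≥0∞ :=
  ⨅ (Ψ : WaveFn d (Fin N)) (_ : Ψ ∈ vanishingSpace d (Fin N) s k)
    (_ : ∫⁻ x in {x : Config d (Fin N) | ∀ l, x l ∈ Ω}, ‖Ψ x‖ₑ ^ 2 = 1),
    fullyLocalEnergy s Ω (Ψ : Config d (Fin N) → ℂ)

/-- The one-body density `∑_j ∫_{(ℝ^d)^{N-1}} |Ψ(…, x_j = x, …)|² ∏_{l ≠ j} dx_l`. -/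
def density {d : ℕ} {ι : Type*} [Fintype ι] [DecidableEq ι]
    (Ψ : Config d ι → ℂ) (x : Pos d) : ℝ≥0∞ :=
  ∑ j : ι, ∫⁻ x' : {l : ι // l ≠ j} → Pos d, ‖Ψ (insertAt j x x')‖ₑ ^ 2

end ManyBody

end

/-! Put `n = ⌈q⌉₊`. Only the ground-state energy `G > 0` of `n` particles on the unit cube is used;
every other cube is reduced to the unit cube by translation and scaling, which produces
`|Q|^{-2s/d}`.

Configuration space is partitioned by the set `A` of particles lying in `Q`; let `p_A` be the mass
of `|Ψ|²` on the pattern `A`. Then `∑ p_A = 1` and `∫_Q ϱ = ∑ |A| p_A`. Patterns with `|A| < n` have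
`|A| < q`, so they contribute at most `q`, and `∫_Q ϱ - q ≤ ∑_{|A| ≥ n} |A| p_A`.

On a pattern with `|A| ≥ n`, split `A` into `⌊|A|/n⌋ ≥ |A|/(2n)` disjoint blocks of `n` particles
and discard the rest. For one block, freeze all other particles. Almost every slice of `Ψ` is an
`n`-particle function in the closed vanishing space, so its energy on `Q` is at least `G l^{-2s}`
times its mass on `Q^n`, where `l` is the side of `Q`. Integrating over the frozen particles, then
summing over blocks and patterns, bounds the local energy below by `(G / 2n) l^{-2s} ∑_{|A| ≥ n} |A|
p_A`. The combinatorial step is `groundEnergy_mul_density_le`, resting on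
`groundEnergy_mul_pattern_le` and `card_mul_le_sum`.

The analytic work is to justify slicing. `ae_slice_mem_vanishingSpace` shows that slices remain in
the `H^s` closure: Plancherel in the frozen variables bounds the integrated `H^s` norms of slices by
the full norm, so an approximation with summable errors converges on almost every slice.
`exists_isWeakDeriv_slice` realizes the weak derivatives of the slices as slices of one `L²`
function, which gives measurability of the energies and permits Tonelli. -/

set_option linter.unusedSectionVars false

namespace ManyBody

/-! ### The `H^s` norm on the Fourier side. -/

section Sobolev

variable {V : Type*} [NormedAddCommGroup V] [InnerProductSpace ℝ V] [FiniteDimensional ℝ V]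
  [MeasurableSpace V] [BorelSpace V]

theorem enorm_sq_eq_lintegral {α : Type*} [MeasurableSpace α] {μ : Measure α} (u : Lp ℂ 2 μ) :
    ‖u‖ₑ ^ 2 = ∫⁻ x, ‖u x‖ₑ ^ 2 ∂μ := by
  rw [Lp.enorm_def, eLpNorm_eq_lintegral_rpow_enorm_toReal (by norm_num) (by norm_num),
    ← ENNReal.rpow_natCast, ← ENNReal.rpow_mul]
  simp

/-- The weight `1 + |p|^{2s}` with `p = 2π ξ`. -/
noncomputable def sobolevWeight (s : ℝ) (ξ : V) : ℝ≥0∞ :=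
  1 + ENNReal.ofReal ((2 * Real.pi * ‖ξ‖) ^ (2 * s))

theorem measurable_sobolevWeight (s : ℝ) : Measurable (sobolevWeight s : V → ℝ≥0∞) := by
  unfold sobolevWeight
  fun_prop

theorem sobolevSq_eq_lintegral (s : ℝ) (u : Lp ℂ 2 (volume : Measure V)) :
    sobolevSq s u = ∫⁻ ξ : V, sobolevWeight s ξ * ‖(𝓕 u : Lp ℂ 2 volume) ξ‖ₑ ^ 2 := by
  have h : ‖u‖ₑ = ‖(𝓕 u : Lp ℂ 2 (volume : Measure V))‖ₑ := by
    rw [← ofReal_norm, ← ofReal_norm, Lp.norm_fourier_eq]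
  rw [sobolevSq, homSobolevSq, h, enorm_sq_eq_lintegral, ← lintegral_add_left']
  · simp only [sobolevWeight, add_mul, one_mul]
  · exact ((Lp.aestronglyMeasurable _).enorm).pow_const 2

/-- On `L¹ ∩ L²` the Fourier transform of `L²` is given by the Fourier integral. -/
theorem fourier_toLp_ae_eq {f : V → ℂ} (h1 : Integrable f) (h2 : MemLp f 2) :
    (𝓕 (h2.toLp f) : Lp ℂ 2 (volume : Measure V)) =ᵐ[volume] 𝓕 f := by
  have hc : Continuous (𝓕 f) :=
    VectorFourier.fourierIntegral_continuous Real.continuous_fourierChar continuous_inner h1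
  refine ae_eq_of_integral_contDiff_smul_eq ((Lp.memLp _).locallyIntegrable (by norm_num))
    hc.locallyIntegrable fun g hg hgc => ?_
  have hg₁ : HasCompactSupport (Complex.ofRealCLM ∘ g) := hgc.comp_left rfl
  have hg₂ : ContDiff ℝ ∞ (Complex.ofRealCLM ∘ g) := by fun_prop
  set G := hg₁.toSchwartzMap hg₂ with hG
  -- The `L²` transform agrees with the distributional one, so testing it against `G` gives `∫ f · 𝓕
  -- G`; Fubini gives the same value for the Fourier integral.
  have e1 := DFunLike.congr_fun (Lp.fourier_toTemperedDistribution_eq (h2.toLp f)) G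
  rw [TemperedDistribution.fourier_apply, Lp.toTemperedDistribution_apply,
    Lp.toTemperedDistribution_apply] at e1
  have e2 : ∫ x, g x • (𝓕 (h2.toLp f) : Lp ℂ 2 (volume : Measure V)) x =
      ∫ x, G x • (𝓕 (h2.toLp f) : Lp ℂ 2 (volume : Measure V)) x := by
    simp [hG]
  have e3 : ∫ x, (𝓕 G) x • (h2.toLp f) x = ∫ x, f x • 𝓕 (G : V → ℂ) x := by
    refine integral_congr_ae ?_
    filter_upwards [h2.coeFn_toLp] with x hx
    rw [hx, SchwartzMap.fourier_coe, smul_eq_mul, smul_eq_mul, mul_comm]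
  have e4 := VectorFourier.integral_fourierIntegral_smul_eq_flip (μ := volume) (ν := volume)
    (L := innerₗ V) (f := f) (g := (G : V → ℂ)) Real.continuous_fourierChar continuous_inner h1
    G.integrable
  rw [flip_innerₗ] at e4
  rw [e2, ← e1, e3]
  refine e4.symm.trans (integral_congr_ae (Filter.Eventually.of_forall fun x => ?_))
  simp only [hG, smul_eq_mul]
  rw [mul_comm]
  rfl

/-- The squared `H^s` norm in terms of the Fourier integral. -/
noncomputable def sobolevIntegral (s : ℝ) (f : V → ℂ) : ℝ≥0∞ :=
  ∫⁻ ξ : V, sobolevWeight s ξ * ‖𝓕 f ξ‖ₑ ^ 2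

theorem sobolevSq_eq_sobolevIntegral (s : ℝ) {u : Lp ℂ 2 (volume : Measure V)} {f : V → ℂ}
    (h1 : Integrable f) (huf : u =ᵐ[volume] f) : sobolevSq s u = sobolevIntegral s f := by
  have h2 : MemLp f 2 := (memLp_congr_ae huf).1 (Lp.memLp u)
  have hu : u = h2.toLp f := Lp.ext (huf.trans h2.coeFn_toLp.symm)
  rw [hu, sobolevSq_eq_lintegral, sobolevIntegral]
  refine lintegral_congr_ae ?_
  filter_upwards [fourier_toLp_ae_eq h1 h2] with x hx
  rw [hx]

theorem lintegral_fourier_sq {f : V → ℂ} (h1 : Integrable f) (h2 : MemLp f 2) :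
    ∫⁻ ξ, ‖𝓕 f ξ‖ₑ ^ 2 = ∫⁻ x, ‖f x‖ₑ ^ 2 := by
  have e : ‖(𝓕 (h2.toLp f) : Lp ℂ 2 (volume : Measure V))‖ₑ = ‖h2.toLp f‖ₑ := by
    rw [← ofReal_norm, ← ofReal_norm, Lp.norm_fourier_eq]
  have e' := congrArg (· ^ 2) e
  simp only [enorm_sq_eq_lintegral] at e'
  rw [lintegral_congr_ae ((fourier_toLp_ae_eq h1 h2).symm.mono fun x hx => by rw [hx]), e']
  exact lintegral_congr_ae (h2.coeFn_toLp.mono fun x hx => by simp only [hx])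

/-- Lower semicontinuity of the `H^s` norm under convergence in `L²`. -/
theorem sobolevSq_le_liminf (s : ℝ) {u : Lp ℂ 2 (volume : Measure V)}
    {v : ℕ → Lp ℂ 2 (volume : Measure V)} (h : Filter.Tendsto v Filter.atTop (nhds u)) :
    sobolevSq s u ≤ Filter.liminf (fun n => sobolevSq s (v n)) Filter.atTop := by
  by_contra! hlt
  obtain ⟨c, hc1, hc2⟩ := exists_between hlt
  -- One subsequence keeps the norms below `c`, a further one makes the Fourier transforms converge
  -- almost everywhere, and Fatou's lemma then gives `sobolevSq s u ≤ c`.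
  obtain ⟨φ, hφ, hφc⟩ := Filter.extraction_of_frequently_atTop
    (Filter.frequently_lt_of_liminf_lt (by isBoundedDefault) hc1)
  have h1 : Filter.Tendsto (fun n => (𝓕 (v (φ n)) : Lp ℂ 2 (volume : Measure V))) Filter.atTop
      (nhds (𝓕 u)) :=
    ((Lp.fourierTransformₗᵢ V ℂ).continuous.tendsto u).comp (h.comp hφ.tendsto_atTop)
  obtain ⟨ns, -, hns⟩ := (tendstoInMeasure_of_tendsto_Lp h1).exists_seq_tendsto_ae
  refine absurd hc2 (not_lt.2 ?_)
  calc sobolevSq s u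
      = ∫⁻ ξ : V, sobolevWeight s ξ * ‖(𝓕 u : Lp ℂ 2 volume) ξ‖ₑ ^ 2 :=
        sobolevSq_eq_lintegral s u
    _ ≤ ∫⁻ ξ : V, Filter.liminf (fun n => sobolevWeight s ξ *
          ‖(𝓕 (v (φ (ns n))) : Lp ℂ 2 volume) ξ‖ₑ ^ 2) Filter.atTop := by
        refine lintegral_mono_ae ?_
        filter_upwards [hns] with ξ hξ
        refine (Filter.Tendsto.liminf_eq ?_).ge
        refine ENNReal.Tendsto.const_mul ?_ (Or.inr (by simp [sobolevWeight]))
        exact (((ENNReal.continuous_pow 2).comp continuous_enorm).tendsto _).comp hξ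
    _ ≤ Filter.liminf (fun n => ∫⁻ ξ : V, sobolevWeight s ξ *
          ‖(𝓕 (v (φ (ns n))) : Lp ℂ 2 volume) ξ‖ₑ ^ 2) Filter.atTop := by
        refine lintegral_liminf_le' fun n => ?_
        exact (measurable_sobolevWeight s).aemeasurable.mul
          ((Lp.aestronglyMeasurable _).enorm.pow_const 2)
    _ ≤ c := by
        refine Filter.liminf_le_of_frequently_le' (Filter.Frequently.of_forall fun n => ?_)
        rw [← sobolevSq_eq_lintegral]
        exact (hφc _).le

theorem sobolevSq_add_le (s : ℝ) (u v : Lp ℂ 2 (volume : Measure V)) :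
    sobolevSq s (u + v) ≤ 2 * (sobolevSq s u + sobolevSq s v) := by
  simp only [sobolevSq_eq_lintegral]
  have hm : ∀ w : Lp ℂ 2 (volume : Measure V), AEMeasurable fun ξ : V => sobolevWeight s ξ *
      ‖w ξ‖ₑ ^ 2 := fun w => (measurable_sobolevWeight s).aemeasurable.mul
        ((Lp.aestronglyMeasurable _).enorm.pow_const 2)
  rw [← lintegral_add_left' (hm _), ← lintegral_const_mul' _ _ (by norm_num)]
  have e : (𝓕 (u + v) : Lp ℂ 2 (volume : Measure V)) = 𝓕 u + 𝓕 v :=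
    (Lp.fourierTransformₗᵢ V ℂ).map_add u v
  refine lintegral_mono_ae ?_
  rw [e]
  filter_upwards [Lp.coeFn_add (𝓕 u : Lp ℂ 2 (volume : Measure V)) (𝓕 v)] with ξ hξ
  rw [hξ, Pi.add_apply, ← mul_add, mul_left_comm]
  gcongr
  refine (pow_le_pow_left' (enorm_add_le _ _) 2).trans ?_
  have := ENNReal.rpow_add_le_mul_rpow_add_rpow ‖(𝓕 u : Lp ℂ 2 (volume : Measure V)) ξ‖ₑ
    ‖(𝓕 v : Lp ℂ 2 (volume : Measure V)) ξ‖ₑ (p := 2) (by norm_num)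
  norm_num at this
  exact_mod_cast this

theorem sobolevSq_smul (s : ℝ) (c : ℂ) (u : Lp ℂ 2 (volume : Measure V)) :
    sobolevSq s (c • u) = ‖c‖ₑ ^ 2 * sobolevSq s u := by
  simp only [sobolevSq_eq_lintegral]
  have e : (𝓕 (c • u) : Lp ℂ 2 (volume : Measure V)) = c • 𝓕 u :=
    (Lp.fourierTransformₗᵢ V ℂ).map_smul c u
  rw [← lintegral_const_mul' _ _ (by simp), e]
  refine lintegral_congr_ae ?_
  filter_upwards [Lp.coeFn_smul c (𝓕 u : Lp ℂ 2 (volume : Measure V))] with ξ hξ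
  rw [hξ, Pi.smul_apply, enorm_smul, mul_pow, mul_left_comm]

theorem enorm_sq_le_sobolevSq (s : ℝ) (u : Lp ℂ 2 (volume : Measure V)) :
    ‖u‖ₑ ^ 2 ≤ sobolevSq s u := le_self_add

end Sobolev

/-- The sum of the `f n` has finite integral, hence is finite almost everywhere, and the terms of a
convergent series tend to zero. This passes from convergence of integrals over slices to almost
every single slice. -/
theorem ae_tendsto_zero_of_lintegral_le {α : Type*} [MeasurableSpace α] {μ : Measure α}
    {f : ℕ → α → ℝ≥0∞} (hf : ∀ n, AEMeasurable (f n) μ) {b : ℕ → ℝ≥0∞}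
    (hb : ∑' n, b n ≠ ⊤) (h : ∀ n, ∫⁻ x, f n x ∂μ ≤ b n) :
    ∀ᵐ x ∂μ, Filter.Tendsto (fun n => f n x) Filter.atTop (nhds 0) := by
  have h1 : ∫⁻ x, ∑' n, f n x ∂μ ≠ ⊤ := by
    rw [lintegral_tsum hf]
    exact ne_top_of_le_ne_top hb (ENNReal.tsum_le_tsum h)
  filter_upwards [ae_lt_top' (AEMeasurable.tsum hf) h1] with x hx
  exact ENNReal.tendsto_atTop_zero_of_tsum_ne_top hx.ne

theorem lintegral_comp_affine {E : Type*} [NormedAddCommGroup E] [NormedSpace ℝ E]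
    [FiniteDimensional ℝ E] [MeasurableSpace E] [BorelSpace E] (μ : Measure E)
    [μ.IsAddHaarMeasure] (f : E → ℝ≥0∞) (a : E) {r : ℝ} (hr : 0 < r) :
    ∫⁻ x, f (a + r • x) ∂μ = ENNReal.ofReal ((r ^ Module.finrank ℝ E)⁻¹) * ∫⁻ x, f x ∂μ := by
  have e1 : ∫⁻ x, f (a + r • x) ∂μ = ∫⁻ y, f (a + y) ∂(Measure.map (fun x : E => r • x) μ) :=
    ((MeasurableEquiv.smul₀ r hr.ne').measurableEmbedding.lintegral_map
      (fun y : E => f (a + y))).symm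
  rw [e1, Measure.map_addHaar_smul _ hr.ne', lintegral_smul_measure,
    lintegral_add_left_eq_self (μ := μ) f a, abs_of_pos (by positivity), smul_eq_mul]

/-! ### Affine changes of variable and the `H^s` norm. -/

section Affine

variable {X : Type*} [NormedAddCommGroup X] [InnerProductSpace ℝ X] [FiniteDimensional ℝ X]
  [MeasurableSpace X] [BorelSpace X]

/-- The translation contributes only a unimodular phase, so in absolute value just the dilation is
visible. -/
theorem enorm_fourier_comp_affine (f : X → ℂ) (a : X) {r : ℝ} (hr : 0 < r) (ξ : X) :
    ‖𝓕 (fun x => f (a + r • x)) ξ‖ₑ =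
      ENNReal.ofReal ((r ^ Module.finrank ℝ X)⁻¹) * ‖𝓕 f (r⁻¹ • ξ)‖ₑ := by
  set g : X → ℂ := fun y => Real.fourierChar (-inner ℝ (y - a) (r⁻¹ • ξ)) • f y with hg
  have e1 : 𝓕 (fun x => f (a + r • x)) ξ = ∫ x, g (a + r • x) := by
    rw [Real.fourier_eq]
    refine integral_congr_ae (Filter.Eventually.of_forall fun x => ?_)
    simp only [hg, add_sub_cancel_left, inner_smul_left, inner_smul_right]
    rw [show r⁻¹ * ((starRingEnd ℝ) r * inner ℝ x ξ) = inner ℝ x ξ by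
      simp only [conj_trivial]; field_simp]
  have e2 : ∫ x, g x =
      ((Real.fourierChar (inner ℝ a (r⁻¹ • ξ)) : Circle) : ℂ) * 𝓕 f (r⁻¹ • ξ) := by
    rw [Real.fourier_eq, ← integral_const_mul]
    refine integral_congr_ae (Filter.Eventually.of_forall fun x => ?_)
    simp only [hg, inner_sub_left, neg_sub, Circle.smul_def, smul_eq_mul]
    rw [sub_eq_add_neg, AddChar.map_add_eq_mul, Circle.coe_mul, mul_assoc]
  have e3 : ∫ x, g (a + r • x) = (r ^ Module.finrank ℝ X)⁻¹ • ∫ x, g x := by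
    rw [Measure.integral_comp_smul volume (fun x => g (a + x)) r,
      integral_add_left_eq_self (μ := volume) g a, abs_of_pos (by positivity)]
  rw [e1, e3, e2, enorm_smul, enorm_mul, Real.enorm_eq_ofReal (by positivity)]
  congr 1
  rw [← ofReal_norm, Circle.norm_coe, ENNReal.ofReal_one, one_mul]

theorem sobolevWeight_smul_le (s : ℝ) {r : ℝ} (hr : 0 < r) (ξ : X) :
    sobolevWeight s (r • ξ) ≤ ENNReal.ofReal (1 + r ^ (2 * s)) * sobolevWeight s ξ := by
  have e : (2 * Real.pi * ‖r • ξ‖) ^ (2 * s) = r ^ (2 * s) * (2 * Real.pi * ‖ξ‖) ^ (2 * s) := by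
    rw [norm_smul, Real.norm_of_nonneg hr.le, ← Real.mul_rpow hr.le (by positivity)]
    ring_nf
  have h1 : (0 : ℝ) ≤ r ^ (2 * s) := by positivity
  have h2 : (0 : ℝ) ≤ (2 * Real.pi * ‖ξ‖) ^ (2 * s) := by positivity
  rw [sobolevWeight, sobolevWeight, e, ← ENNReal.ofReal_one, ← ENNReal.ofReal_add zero_le_one h2,
    ← ENNReal.ofReal_add zero_le_one (by positivity), ← ENNReal.ofReal_mul (by positivity)]
  refine ENNReal.ofReal_le_ofReal ?_
  nlinarith

/-- Exact scaling is not needed: a finite factor independent of `f` suffices to transfer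
convergence. -/
theorem sobolevIntegral_comp_affine_le (s : ℝ) (f : X → ℂ) (a : X) {r : ℝ} (hr : 0 < r) :
    sobolevIntegral s (fun x => f (a + r • x)) ≤
      ENNReal.ofReal ((r ^ Module.finrank ℝ X)⁻¹) * ENNReal.ofReal (1 + r ^ (2 * s)) *
        sobolevIntegral s f := by
  set c := ENNReal.ofReal ((r ^ Module.finrank ℝ X)⁻¹) with hc
  -- The dilation gives the square of `c`; substituting in the frequency variable cancels one of the
  -- two factors.
  have hc' : c * ENNReal.ofReal (((r⁻¹) ^ Module.finrank ℝ X)⁻¹) = 1 := by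
    rw [hc, ← ENNReal.ofReal_mul (by positivity), ← mul_inv, ← mul_pow, mul_inv_cancel₀ hr.ne',
      one_pow, inv_one, ENNReal.ofReal_one]
  have e1 : sobolevIntegral s (fun x => f (a + r • x)) =
      c ^ 2 * ∫⁻ ξ : X, sobolevWeight s (r • r⁻¹ • ξ) * ‖𝓕 f (r⁻¹ • ξ)‖ₑ ^ 2 := by
    rw [sobolevIntegral, ← lintegral_const_mul' _ _ (by simp [hc])]
    refine lintegral_congr fun ξ => ?_
    rw [enorm_fourier_comp_affine f a hr, smul_inv_smul₀ hr.ne', mul_pow, mul_left_comm]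
  have e2 : ∫⁻ ξ : X, sobolevWeight s (r • r⁻¹ • ξ) * ‖𝓕 f (r⁻¹ • ξ)‖ₑ ^ 2 =
      ENNReal.ofReal (((r⁻¹) ^ Module.finrank ℝ X)⁻¹) *
        ∫⁻ ξ : X, sobolevWeight s (r • ξ) * ‖𝓕 f ξ‖ₑ ^ 2 := by
    simpa using lintegral_comp_affine volume (fun ξ : X => sobolevWeight s (r • ξ) * ‖𝓕 f ξ‖ₑ ^ 2) 0
      (inv_pos.2 hr)
  rw [e1, e2, sq, mul_assoc c c, ← mul_assoc c (ENNReal.ofReal (((r⁻¹) ^ Module.finrank ℝ X)⁻¹)),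
    hc', one_mul, mul_assoc c]
  gcongr
  rw [sobolevIntegral, ← lintegral_const_mul' _ _ (by simp)]
  refine lintegral_mono fun ξ => ?_
  rw [← mul_assoc]
  gcongr
  exact sobolevWeight_smul_le s hr ξ

end Affine

/-! ### Restriction of `H^s` functions to slices. -/

section Slice

variable {X Y V : Type*}
  [NormedAddCommGroup X] [InnerProductSpace ℝ X] [FiniteDimensional ℝ X]
  [MeasurableSpace X] [BorelSpace X]
  [NormedAddCommGroup Y] [InnerProductSpace ℝ Y] [FiniteDimensional ℝ Y]
  [MeasurableSpace Y] [BorelSpace Y]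
  [NormedAddCommGroup V] [InnerProductSpace ℝ V] [FiniteDimensional ℝ V]
  [MeasurableSpace V] [BorelSpace V]
  (L : WithLp 2 (X × Y) ≃ₗᵢ[ℝ] V)

/-- The point of `V` with components `x` and `z` in an orthogonal decomposition of `V`. -/
noncomputable def join (x : X) (z : Y) : V := L (WithLp.toLp 2 (x, z))

theorem continuous_join : Continuous fun p : X × Y => join L p.1 p.2 := by
  unfold join
  exact L.continuous.comp (WithLp.prod_continuous_toLp 2 X Y)

theorem measurePreserving_join :
    MeasurePreserving (fun p : X × Y => join L p.1 p.2) (volume.prod volume) volume :=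
  L.measurePreserving.comp (WithLp.volume_preserving_toLp X Y)

theorem lintegral_join {f : V → ℝ≥0∞} (hf : AEMeasurable f) :
    ∫⁻ v, f v = ∫⁻ z, ∫⁻ x, f (join L x z) := by
  rw [← (measurePreserving_join L).map_eq,
    lintegral_map' (by rwa [(measurePreserving_join L).map_eq])
      (measurePreserving_join L).measurable.aemeasurable]
  exact lintegral_prod_symm _
    (hf.comp_quasiMeasurePreserving (measurePreserving_join L).quasiMeasurePreserving)

theorem ae_ae_join {p : V → Prop} (h : ∀ᵐ v, p v) : ∀ᵐ z, ∀ᵐ x, p (join L x z) := by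
  have h1 := (measurePreserving_join L).quasiMeasurePreserving.ae h
  exact Measure.ae_ae_of_ae_prod ((Measure.measurePreserving_swap (μ := (volume : Measure Y))
    (ν := (volume : Measure X))).quasiMeasurePreserving.ae h1)

theorem inner_join (x x' : X) (z z' : Y) :
    inner ℝ (join L x z) (join L x' z') = inner ℝ x x' + inner ℝ z z' := by
  simp [join, LinearIsometryEquiv.inner_map_map, WithLp.prod_inner_apply]

theorem norm_le_norm_join (x : X) (z : Y) : ‖x‖ ≤ ‖join L x z‖ := by
  have h := inner_join L x x z z
  simp only [real_inner_self_eq_norm_sq] at h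
  nlinarith [norm_nonneg (join L x z), norm_nonneg x, sq_nonneg ‖z‖]

theorem norm_le_norm_join' (x : X) (z : Y) : ‖z‖ ≤ ‖join L x z‖ := by
  have h := inner_join L x x z z
  simp only [real_inner_self_eq_norm_sq] at h
  nlinarith [norm_nonneg (join L x z), norm_nonneg z, sq_nonneg ‖x‖]

theorem exists_support_bound {φ : V → ℂ} (h : HasCompactSupport φ) :
    ∃ R : ℝ, ∀ v, φ v ≠ 0 → ‖v‖ ≤ R := by
  obtain ⟨R, hR⟩ := h.isCompact.isBounded.exists_norm_le
  exact ⟨R, fun v hv => hR v (subset_tsupport _ hv)⟩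

/-- Plancherel's theorem in one of two groups of variables. -/
theorem lintegral_fourier_slice_sq {φ : V → ℂ} (hc : Continuous φ) (hs : HasCompactSupport φ)
    (p : X) : ∫⁻ z, ‖𝓕 (fun x => φ (join L x z)) p‖ₑ ^ 2 =
      ∫⁻ t : Y, ‖𝓕 φ (join L p t)‖ₑ ^ 2 := by
  obtain ⟨R, hR⟩ := exists_support_bound hs
  set h : Y → ℂ := fun z => 𝓕 (fun x => φ (join L x z)) p with hh
  have hJ := continuous_join L
  have hint : Continuous fun q : Y × X =>
      Real.fourierChar (-inner ℝ q.2 p) • φ (join L q.2 q.1) := by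
    have : Continuous fun q : Y × X => φ (join L q.2 q.1) :=
      hc.comp (hJ.comp continuous_swap)
    exact (Real.continuous_fourierChar.comp (by fun_prop)).smul this
  -- The bounded support allows integration over one fixed ball, where a parametric integral of a
  -- continuous function is continuous.
  have hcont : Continuous h := by
    have e : h = fun z => ∫ x in Metric.closedBall (0 : X) R,
        Real.fourierChar (-inner ℝ x p) • φ (join L x z) := by
      funext z
      rw [hh]
      simp only
      rw [Real.fourier_eq]
      refine (setIntegral_eq_integral_of_forall_compl_eq_zero fun x hx => ?_).symm
      by_contra hne
      refine hx (mem_closedBall_zero_iff.2 ((norm_le_norm_join L x z).trans (hR _ fun h0 => ?_)))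
      simp [h0] at hne
    rw [e]
    exact continuous_parametric_integral_of_continuous
      (f := fun (z : Y) (x : X) => Real.fourierChar (-inner ℝ x p) • φ (join L x z)) hint
      (isCompact_closedBall _ _)
  have hsupp : HasCompactSupport h := by
    refine HasCompactSupport.intro (isCompact_closedBall (0 : Y) R) fun z hz => ?_
    have : ∀ x, φ (join L x z) = 0 := fun x => by
      by_contra hne
      exact hz (mem_closedBall_zero_iff.2 ((norm_le_norm_join' L x z).trans (hR _ hne)))
    simp [hh, this, Real.fourier_eq]
  -- Fubini: transforming in `x` and then in `z` is the full transform, since the phase factors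
  -- along the orthogonal decomposition.
  have hF : ∀ t, 𝓕 h t = 𝓕 φ (join L p t) := by
    intro t
    have hi : Integrable fun v => Real.fourierChar (-inner ℝ v (join L p t)) • φ v := by
      refine Continuous.integrable_of_hasCompactSupport ?_ hs.smul_left
      exact (Real.continuous_fourierChar.comp (by fun_prop)).smul hc
    have e1 : 𝓕 φ (join L p t) = ∫ q : X × Y,
        Real.fourierChar (-inner ℝ (join L q.1 q.2) (join L p t)) • φ (join L q.1 q.2)
          ∂(volume.prod volume) := by
      rw [Real.fourier_eq, ← (measurePreserving_join L).map_eq, integral_map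
        (measurePreserving_join L).measurable.aemeasurable]
      rw [(measurePreserving_join L).map_eq]
      exact hi.aestronglyMeasurable
    rw [e1, integral_prod_symm (fun q : X × Y =>
      Real.fourierChar (-inner ℝ (join L q.1 q.2) (join L p t)) • φ (join L q.1 q.2))
        ((measurePreserving_join L).integrable_comp_of_integrable hi), Real.fourier_eq]
    refine integral_congr_ae (Filter.Eventually.of_forall fun z => ?_)
    simp only [hh, Real.fourier_eq, Circle.smul_def, smul_eq_mul]
    rw [← integral_const_mul]
    refine integral_congr_ae (Filter.Eventually.of_forall fun x => ?_)
    simp only []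
    rw [inner_join, neg_add, AddChar.map_add_eq_mul, Circle.coe_mul]
    ring
  rw [← lintegral_fourier_sq (hcont.integrable_of_hasCompactSupport hsupp)
    (hcont.memLp_of_hasCompactSupport hsupp)]
  simp only [hF]

theorem sobolevWeight_le_join {s : ℝ} (hs : 0 ≤ s) (x : X) (z : Y) :
    sobolevWeight s x ≤ sobolevWeight s (join L x z) := by
  unfold sobolevWeight
  have := norm_le_norm_join L x z
  gcongr

/-- The restriction of `u` to an affine slice, in the coordinate `(· - a) / r`. -/
noncomputable def slice (a : X) (r : ℝ) (u : V → ℂ) (z : Y) : X → ℂ :=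
  fun x => u (join L (a + r • x) z)

theorem continuous_uncurry_slice (a : X) (r : ℝ) {φ : V → ℂ} (hc : Continuous φ) :
    Continuous fun q : Y × X => slice L a r φ q.1 q.2 :=
  hc.comp ((continuous_join L).comp (f := fun q : Y × X => (a + r • q.2, q.1)) (by fun_prop))

theorem continuous_slice (a : X) (r : ℝ) {φ : V → ℂ} (hc : Continuous φ) (z : Y) :
    Continuous (slice L a r φ z) :=
  (continuous_uncurry_slice L a r hc).comp (Continuous.prodMk_right z)

theorem measurable_slice (a : X) (r : ℝ) {u : V → ℂ} (hu : Measurable u) :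
    Measurable fun q : Y × X => slice L a r u q.1 q.2 :=
  hu.comp ((continuous_join L).comp (f := fun q : Y × X => (a + r • q.2, q.1))
    (by fun_prop)).measurable

theorem hasCompactSupport_slice (a : X) {r : ℝ} (hr : 0 < r) {φ : V → ℂ}
    (hs : HasCompactSupport φ) (z : Y) : HasCompactSupport (slice L a r φ z) := by
  obtain ⟨R, hR⟩ := exists_support_bound hs
  refine HasCompactSupport.intro (isCompact_closedBall (0 : X) (r⁻¹ * (R + ‖a‖))) fun x hx => ?_
  by_contra hne
  refine hx (mem_closedBall_zero_iff.2 ?_)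
  have h1 := (norm_le_norm_join L _ z).trans (hR _ hne)
  have h2 : r * ‖x‖ = ‖(a + r • x) - a‖ := by
    rw [add_sub_cancel_left, norm_smul, Real.norm_of_nonneg hr.le]
  have h3 := norm_sub_le (a + r • x) a
  rw [le_inv_mul_iff₀ hr, h2]
  linarith

theorem measurable_sobolevIntegral_slice (s : ℝ) (a : X) (r : ℝ) {φ : V → ℂ}
    (hc : Continuous φ) : Measurable fun z : Y => sobolevIntegral s (slice L a r φ z) := by
  have h1 : StronglyMeasurable fun q : Y × X => 𝓕 (slice L a r φ q.1) q.2 := by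
    simp only [Real.fourier_eq]
    refine StronglyMeasurable.integral_prod_right (ν := (volume : Measure X))
      (f := fun (q : Y × X) (x : X) =>
        Real.fourierChar (-inner ℝ x q.2) • slice L a r φ q.1 x) ?_
    refine Continuous.stronglyMeasurable ?_
    refine (Real.continuous_fourierChar.comp (by fun_prop)).smul ?_
    exact (continuous_uncurry_slice L a r hc).comp
      (f := fun p : (Y × X) × X => (p.1.1, p.2)) (by fun_prop)
  unfold sobolevIntegral
  exact Measurable.lintegral_prod_right' (f := fun q : Y × X => sobolevWeight s q.2 *
    ‖𝓕 (slice L a r φ q.1) q.2‖ₑ ^ 2)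
    (((measurable_sobolevWeight s).comp measurable_snd).mul (h1.measurable.enorm.pow_const 2))

/-- Plancherel in the frozen variable `z` turns the left side into an integral of the full Fourier
transform against the weight of the partial momentum `p`, which is at most the weight of `(p, t)`.
-/
theorem lintegral_sobolevIntegral_slice_le {s : ℝ} (hs0 : 0 ≤ s) (a : X) {r : ℝ} (hr : 0 < r)
    {φ : V → ℂ} (hc : Continuous φ) (hs : HasCompactSupport φ) :
    ∫⁻ z : Y, sobolevIntegral s (slice L a r φ z) ≤
      ENNReal.ofReal ((r ^ Module.finrank ℝ X)⁻¹) * ENNReal.ofReal (1 + r ^ (2 * s)) *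
        sobolevIntegral s φ := by
  refine (lintegral_mono fun z =>
    sobolevIntegral_comp_affine_le s (fun x => φ (join L x z)) a hr).trans ?_
  rw [lintegral_const_mul' _ _ (by finiteness)]
  gcongr
  have h1 : StronglyMeasurable fun q : X × Y => 𝓕 (fun x => φ (join L x q.2)) q.1 := by
    simp only [Real.fourier_eq]
    refine StronglyMeasurable.integral_prod_right (ν := (volume : Measure X))
      (f := fun (q : X × Y) (x : X) =>
        Real.fourierChar (-inner ℝ x q.1) • φ (join L x q.2)) ?_
    refine Continuous.stronglyMeasurable ?_
    refine (Real.continuous_fourierChar.comp (by fun_prop)).smul ?_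
    exact hc.comp ((continuous_join L).comp
      (f := fun p : (X × Y) × X => (p.2, p.1.2)) (by fun_prop))
  have hcF : Continuous (𝓕 φ) :=
    VectorFourier.fourierIntegral_continuous Real.continuous_fourierChar continuous_inner
      (hc.integrable_of_hasCompactSupport hs)
  have hm : Measurable fun v => sobolevWeight s v * ‖𝓕 φ v‖ₑ ^ 2 :=
    (measurable_sobolevWeight s).mul (hcF.measurable.enorm.pow_const 2)
  have e : sobolevIntegral s φ = ∫⁻ p : X, ∫⁻ t : Y, sobolevWeight s (join L p t) *
      ‖𝓕 φ (join L p t)‖ₑ ^ 2 := by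
    rw [sobolevIntegral, lintegral_join L hm.aemeasurable, lintegral_lintegral_swap]
    exact (hm.comp ((continuous_join L).comp continuous_swap).measurable).aemeasurable
  rw [e]
  simp only [sobolevIntegral]
  rw [lintegral_lintegral_swap]
  · refine lintegral_mono fun p => ?_
    rw [lintegral_const_mul' _ _ (by simp [sobolevWeight]), lintegral_fourier_slice_sq L hc hs,
      ← lintegral_const_mul' _ _ (by simp [sobolevWeight])]
    refine lintegral_mono fun t => ?_
    gcongr
    exact sobolevWeight_le_join L hs0 p t
  · exact (((measurable_sobolevWeight s).comp measurable_snd).mul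
      ((h1.measurable.comp measurable_swap).enorm.pow_const 2)).aemeasurable

theorem lintegral_slice_sq (a : X) {r : ℝ} (hr : 0 < r) {u : V → ℂ} (hu : Measurable u) :
    ∫⁻ z : Y, ∫⁻ x, ‖slice L a r u z x‖ₑ ^ 2 =
      ENNReal.ofReal ((r ^ Module.finrank ℝ X)⁻¹) * ∫⁻ v, ‖u v‖ₑ ^ 2 := by
  rw [lintegral_join L (hu.enorm.pow_const 2).aemeasurable, ← lintegral_const_mul' _ _ (by simp)]
  exact lintegral_congr fun z => lintegral_comp_affine volume (fun x => ‖u (join L x z)‖ₑ ^ 2) a hr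

theorem memLp_two_iff_lintegral {α : Type*} [MeasurableSpace α] {μ : Measure α} {f : α → ℂ}
    (hf : AEStronglyMeasurable f μ) : MemLp f 2 μ ↔ ∫⁻ x, ‖f x‖ₑ ^ 2 ∂μ < ⊤ := by
  rw [MemLp, and_iff_right hf,
    eLpNorm_lt_top_iff_lintegral_rpow_enorm_lt_top (by norm_num) (by norm_num)]
  simp

theorem tendsto_of_lintegral_sub_sq {α : Type*} [MeasurableSpace α] {μ : Measure α}
    {v : ℕ → Lp ℂ 2 μ} {u : Lp ℂ 2 μ}
    (h : Filter.Tendsto (fun n => ∫⁻ x, ‖u x - v n x‖ₑ ^ 2 ∂μ) Filter.atTop (nhds 0)) :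
    Filter.Tendsto v Filter.atTop (nhds u) := by
  have e : ∀ n, ∫⁻ x, ‖u x - v n x‖ₑ ^ 2 ∂μ = ‖u - v n‖ₑ ^ 2 := fun n => by
    rw [enorm_sq_eq_lintegral]
    refine lintegral_congr_ae ?_
    filter_upwards [Lp.coeFn_sub u (v n)] with x hx
    rw [hx, Pi.sub_apply]
  simp only [e] at h
  have h2 := (ENNReal.continuous_rpow_const (y := 1 / 2)).tendsto 0 |>.comp h
  rw [tendsto_iff_edist_tendsto_0]
  refine (h2.congr fun n => ?_).trans (by simp)
  simp only [Function.comp_apply]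
  rw [← ENNReal.rpow_natCast, ← ENNReal.rpow_mul, edist_comm, edist_eq_enorm_sub]
  norm_num

theorem sobolevSq_sub_le (s : ℝ) (u v w : Lp ℂ 2 (volume : Measure V)) :
    sobolevSq s (u - v) ≤ 2 * (sobolevSq s (w - v) + sobolevSq s (w - u)) := by
  have e : u - v = (w - v) + (-1 : ℂ) • (w - u) := by
    rw [neg_smul, one_smul]; abel
  have h := sobolevSq_add_le s (w - v) ((-1 : ℂ) • (w - u))
  rw [sobolevSq_smul] at h
  rw [e]
  simpa using h

theorem ae_tendsto_slice_sub_sq (a : X) {r : ℝ} (hr : 0 < r) {u : V → ℂ} (hu : Measurable u)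
    {φ : ℕ → V → ℂ} (hφ : ∀ m, Measurable (φ m)) {b : ℕ → ℝ≥0∞} (hb : ∑' m, b m ≠ ⊤)
    (h : ∀ m, ∫⁻ v, ‖u v - φ m v‖ₑ ^ 2 ≤ b m) :
    ∀ᵐ z : Y, Filter.Tendsto
      (fun m => ∫⁻ x, ‖slice L a r u z x - slice L a r (φ m) z x‖ₑ ^ 2) Filter.atTop (nhds 0) := by
  refine ae_tendsto_zero_of_lintegral_le
    (b := fun m => ENNReal.ofReal ((r ^ Module.finrank ℝ X)⁻¹) * b m) (fun m => ?_) ?_ fun m => ?_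
  · exact (Measurable.lintegral_prod_right' (f := fun q : Y × X =>
      ‖slice L a r u q.1 q.2 - slice L a r (φ m) q.1 q.2‖ₑ ^ 2)
      (((measurable_slice L a r hu).sub (measurable_slice L a r (hφ m))).enorm.pow_const
        2)).aemeasurable
  · rw [ENNReal.tsum_mul_left]
    finiteness
  · refine (lintegral_slice_sq L a hr (hu.sub (hφ m))).le.trans ?_
    gcongr
    exact h m

theorem ae_memLp_slice (a : X) {r : ℝ} (hr : 0 < r) (u : Lp ℂ 2 (volume : Measure V)) :
    ∀ᵐ z : Y, MemLp (slice L a r u z) 2 := by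
  have hm : Measurable (u : V → ℂ) := (Lp.stronglyMeasurable u).measurable
  have h1 : ∫⁻ z : Y, ∫⁻ x, ‖slice L a r u z x‖ₑ ^ 2 ≠ ⊤ := by
    rw [lintegral_slice_sq L a hr hm, ← enorm_sq_eq_lintegral]
    finiteness
  have h2 : Measurable fun z : Y => ∫⁻ x, ‖slice L a r u z x‖ₑ ^ 2 :=
    Measurable.lintegral_prod_right' (f := fun q : Y × X => ‖slice L a r u q.1 q.2‖ₑ ^ 2)
      ((measurable_slice L a r hm).enorm.pow_const 2)
  filter_upwards [ae_lt_top h2 h1] with z hz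
  exact (memLp_two_iff_lintegral
    ((measurable_slice L a r hm).comp measurable_prodMk_left).aestronglyMeasurable).2 hz

/-- A fast `H^s` approximation by continuous functions with compact support restricts to an
`H^s` approximation on almost every slice. -/
theorem ae_tendsto_sobolevSq_slice {s : ℝ} (hs0 : 0 ≤ s) (a : X) {r : ℝ} (hr : 0 < r)
    {u : Lp ℂ 2 (volume : Measure V)} {φ : ℕ → V → ℂ} (hc : ∀ m, Continuous (φ m))
    (hs : ∀ m, HasCompactSupport (φ m)) {Φ : ℕ → Lp ℂ 2 (volume : Measure V)}
    (hΦ : ∀ m, Φ m =ᵐ[volume] φ m) (h : ∀ m, sobolevSq s (u - Φ m) ≤ 4⁻¹ ^ m) :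
    ∀ᵐ z : Y, ∀ w : Lp ℂ 2 (volume : Measure X), w =ᵐ[volume] slice L a r u z →
      ∀ v : ℕ → Lp ℂ 2 (volume : Measure X), (∀ m, v m =ᵐ[volume] slice L a r (φ m) z) →
        Filter.Tendsto (fun m => sobolevSq s (w - v m)) Filter.atTop (nhds 0) := by
  have hsum : ∑' m : ℕ, (4⁻¹ : ℝ≥0∞) ^ m ≠ ⊤ := by
    rw [ENNReal.tsum_geometric, ENNReal.inv_ne_top]
    exact (tsub_pos_of_lt (by simp)).ne'
  set K := ENNReal.ofReal ((r ^ Module.finrank ℝ X)⁻¹) * ENNReal.ofReal (1 + r ^ (2 * s)) with hK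
  have hsub : ∀ k m, (Φ k - Φ m : Lp ℂ 2 (volume : Measure V)) =ᵐ[volume] φ k - φ m := fun k m => by
    filter_upwards [Lp.coeFn_sub (Φ k) (Φ m), hΦ k, hΦ m] with x h1 h2 h3
    rw [h1, Pi.sub_apply, Pi.sub_apply, h2, h3]
  have hcd : ∀ k m, Continuous (φ k - φ m) := fun k m => (hc k).sub (hc m)
  have hsd : ∀ k m, HasCompactSupport (φ k - φ m) := fun k m => (hs k).sub (hs m)
  have hA := ae_tendsto_slice_sub_sq L a hr (Lp.stronglyMeasurable u).measurable
    (fun m => (hc m).measurable) hsum fun m => by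
      refine le_trans (le_of_eq ?_) ((enorm_sq_le_sobolevSq s _).trans (h m))
      rw [enorm_sq_eq_lintegral]
      refine lintegral_congr_ae ?_
      filter_upwards [Lp.coeFn_sub u (Φ m), hΦ m] with x h1 h2
      rw [h1, Pi.sub_apply, h2]
  -- The slice inequality is available for continuous compactly supported functions only. Hence `φ k
  -- - φ m` replaces `u - φ m`, and `k → ∞` is taken by a lower limit.
  have hC := ae_tendsto_zero_of_lintegral_le (μ := (volume : Measure Y))
    (f := fun m z => Filter.liminf (fun k => sobolevIntegral s (slice L a r (φ k - φ m) z))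
      Filter.atTop) (b := fun m => K * (4 * 4⁻¹ ^ m))
    (fun m => (Measurable.liminf fun k =>
      measurable_sobolevIntegral_slice L s a r (hcd k m)).aemeasurable)
    (by rw [ENNReal.tsum_mul_left, ENNReal.tsum_mul_left]; finiteness) fun m => by
      refine (lintegral_liminf_le fun k =>
        measurable_sobolevIntegral_slice L s a r (hcd k m)).trans ?_
      refine Filter.liminf_le_of_frequently_le' (Filter.Eventually.frequently ?_)
      filter_upwards [Filter.eventually_ge_atTop m] with k hk
      refine (lintegral_sobolevIntegral_slice_le L hs0 a hr (hcd k m) (hsd k m)).trans ?_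
      gcongr
      rw [← sobolevSq_eq_sobolevIntegral s ((hcd k m).integrable_of_hasCompactSupport (hsd k m))
        (hsub k m)]
      refine (sobolevSq_sub_le s _ _ u).trans ?_
      have h4 : (4⁻¹ : ℝ≥0∞) ^ k ≤ 4⁻¹ ^ m := pow_le_pow_right_of_le_one' (by simp) hk
      calc 2 * (sobolevSq s (u - Φ m) + sobolevSq s (u - Φ k))
          ≤ 2 * (4⁻¹ ^ m + 4⁻¹ ^ m) := by
            gcongr
            · exact h m
            · exact (h k).trans h4
        _ = 4 * 4⁻¹ ^ m := by ring
  filter_upwards [hA, hC] with z hz1 hz2 w hw v hv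
  have hvlim : Filter.Tendsto v Filter.atTop (nhds w) := by
    refine tendsto_of_lintegral_sub_sq (hz1.congr fun m => ?_)
    refine lintegral_congr_ae ?_
    filter_upwards [hw, hv m] with x h1 h2
    rw [h1, h2]
  refine tendsto_of_tendsto_of_tendsto_of_le_of_le tendsto_const_nhds hz2
    (fun m => zero_le) fun m => ?_
  -- Lower semicontinuity replaces `v k` by its `L²` limit `w`.
  refine (sobolevSq_le_liminf s (hvlim.sub_const (v m))).trans (le_of_eq ?_)
  congr 1
  funext k
  refine sobolevSq_eq_sobolevIntegral s
    ((continuous_slice L a r (hcd k m) z).integrable_of_hasCompactSupport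
      (hasCompactSupport_slice L a hr (hsd k m) z)) ?_
  filter_upwards [Lp.coeFn_sub (v k) (v m), hv k, hv m] with x h1 h2 h3
  rw [h1, Pi.sub_apply, h2, h3]
  rfl

end Slice

/-! ### Splitting the particles into groups, and the measures involved. -/

section Geometry

variable {d : ℕ} {ι ν κ : Type*} [Fintype ι] [Fintype ν] [Fintype κ]
  [DecidableEq ι] [DecidableEq ν] [DecidableEq κ]

/-- Configurations of the particles in `ν ⊕ κ ≃ ι` from configurations of the two groups. -/
noncomputable def glue (d : ℕ) (ν κ ι : Type*) [Fintype ν] [Fintype κ] [Fintype ι] (e : ν ⊕ κ ≃ ι) :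
    WithLp 2 (Config d ν × Config d κ) ≃ₗᵢ[ℝ] Config d ι :=
  (PiLp.sumPiLpEquivProdLpPiLp 2 (fun _ : ν ⊕ κ => Pos d)).symm.trans
    (LinearIsometryEquiv.piLpCongrLeft 2 ℝ (Pos d) e)

theorem join_glue_apply (e : ν ⊕ κ ≃ ι) (x : Config d ν) (z : Config d κ) (l : ι) :
    join (glue d ν κ ι e) x z l = Sum.elim x z (e.symm l) := by
  simp only [join, glue, LinearIsometryEquiv.trans_apply,
    LinearIsometryEquiv.piLpCongrLeft_apply]
  simp only [Equiv.piCongrLeft', Equiv.coe_fn_mk]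
  cases e.symm l <;> rfl

theorem join_glue_inl (e : ν ⊕ κ ≃ ι) (x : Config d ν) (z : Config d κ) (b : ν) :
    join (glue d ν κ ι e) x z (e (Sum.inl b)) = x b := by
  simp [join_glue_apply]

theorem join_glue_inr (e : ν ⊕ κ ≃ ι) (x : Config d ν) (z : Config d κ) (b : κ) :
    join (glue d ν κ ι e) x z (e (Sum.inr b)) = z b := by
  simp [join_glue_apply]

theorem insertAt_same (j : ι) (y : Pos d) (z : {l : ι // l ≠ j} → Pos d) :
    insertAt j y z j = y := by
  simp [insertAt]

theorem insertAt_of_ne (j : ι) (y : Pos d) (z : {l : ι // l ≠ j} → Pos d) {l : ι} (h : l ≠ j) :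
    insertAt j y z l = z ⟨l, h⟩ := by
  simp [insertAt, h]

/-- Separation of the particle `j` from the others. -/
noncomputable def insertEquiv (d : ℕ) (ι : Type*) [Fintype ι] [DecidableEq ι] (j : ι) :
    WithLp 2 (Pos d × Config d {l : ι // l ≠ j}) ≃ₗᵢ[ℝ] Config d ι where
  toFun p := insertAt j p.fst p.snd
  invFun x := WithLp.toLp 2 (x j, WithLp.toLp 2 fun l => x l)
  left_inv p := by
    apply WithLp.ofLp_injective
    refine Prod.ext (insertAt_same j _ _) ?_
    ext l : 1
    exact insertAt_of_ne j _ _ l.2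
  right_inv x := by
    ext l : 1
    by_cases h : l = j
    · subst h; simp [insertAt_same]
    · simp [insertAt_of_ne j _ _ h]
  map_add' p p' := by
    ext l : 1
    by_cases h : l = j
    · subst h; simp [insertAt_same]
    · simp [insertAt_of_ne j _ _ h]
  map_smul' c p := by
    ext l : 1
    by_cases h : l = j
    · subst h; simp [insertAt_same]
    · simp [insertAt_of_ne j _ _ h]
  norm_map' p := by
    rw [← sq_eq_sq₀ (norm_nonneg _) (norm_nonneg _)]
    change ‖insertAt j p.fst p.snd‖ ^ 2 = _
    rw [PiLp.norm_sq_eq_of_L2, WithLp.prod_norm_sq_eq_of_L2, PiLp.norm_sq_eq_of_L2 _ p.snd,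
      ← Finset.add_sum_erase _ _ (Finset.mem_univ j), insertAt_same]
    congr 1
    rw [Finset.sum_subtype (Finset.univ.erase j) (p := fun l => l ≠ j) (by simp)
      (fun l => ‖insertAt j p.fst p.snd l‖ ^ 2)]
    refine Finset.sum_congr rfl fun l _ => ?_
    rw [insertAt_of_ne j _ _ l.2]

theorem join_insertEquiv (j : ι) (y : Pos d) (z : Config d {l : ι // l ≠ j}) :
    join (insertEquiv d ι j) y z = insertAt j y z := rfl

theorem slice_insertEquiv (j : ι) (u : Config d ι → ℂ) (z : Config d {l : ι // l ≠ j}) :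
    slice (insertEquiv d ι j) 0 1 u z = fun y => u (insertAt j y z) := by
  funext y
  simp [slice, join_insertEquiv]

theorem volume_preserving_uncurry (ι κ : Type*) [Fintype ι] [Fintype κ] :
    MeasurePreserving (fun (f : ι → κ → ℝ) (p : (_ : ι) × κ) => f p.1 p.2) := by
  refine ⟨by fun_prop, (Measure.pi_eq fun s hs => ?_).symm⟩
  rw [Measure.map_apply (by fun_prop) (MeasurableSet.univ_pi hs)]
  have : (fun (f : ι → κ → ℝ) (p : (_ : ι) × κ) => f p.1 p.2) ⁻¹' (Set.univ.pi s) =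
      Set.univ.pi fun i => Set.univ.pi fun k => s ⟨i, k⟩ := by
    ext f
    simp only [Set.mem_preimage, Set.mem_pi, Set.mem_univ, forall_const]
    exact ⟨fun h i k => h ⟨i, k⟩, fun h p => h p.1 p.2⟩
  rw [this, volume_pi_pi]
  simp only [volume_pi_pi]
  exact (Fintype.prod_sigma fun p : (_ : ι) × κ => volume (s p)).symm

/-- The volume of `Config d ι` comes from its Euclidean structure, while the energies integrate over
`x'` with the product measure. Both are compared with Lebesgue measure on the flat space of all
coordinates. -/
theorem volume_preserving_toLp_config :
    MeasurePreserving (WithLp.toLp 2 : (ι → Pos d) → Config d ι) := by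
  have h1 : MeasurePreserving (fun (x : ι → Pos d) (i : ι) => (x i).ofLp) :=
    volume_preserving_pi (α' := fun _ : ι => Pos d) (β' := fun _ : ι => Fin d → ℝ)
      (f := fun _ x => x.ofLp) fun _ => PiLp.volume_preserving_ofLp (Fin d)
  have h2 := (volume_preserving_uncurry ι (Fin d)).comp h1
  have h3 := (PiLp.volume_preserving_toLp ((_ : ι) × Fin d)).comp h2
  have h4 := (LinearIsometryEquiv.measurePreserving
    (LinearIsometryEquiv.piLpCurry ℝ 2 (fun (_ : ι) (_ : Fin d) => ℝ))).comp h3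
  convert! h4 using 1

theorem lintegral_config (f : (ι → Pos d) → ℝ≥0∞) :
    ∫⁻ z : Config d ι, f z = ∫⁻ z, f z :=
  (volume_preserving_toLp_config.lintegral_comp_emb
    (MeasurableEquiv.toLp 2 (ι → Pos d)).measurableEmbedding _).symm

theorem ae_config {p : (ι → Pos d) → Prop} (h : ∀ᵐ z : Config d ι, p z) : ∀ᵐ z, p z :=
  volume_preserving_toLp_config.quasiMeasurePreserving.ae h

end Geometry

/-! ### Iterated directional derivatives. -/

section DirDerivs

variable {V : Type*} [NormedAddCommGroup V] [InnerProductSpace ℝ V] [FiniteDimensional ℝ V]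
  [MeasurableSpace V] [BorelSpace V]

/-- Iterated directional derivatives; the last direction of the list is applied first. -/
noncomputable def dirDerivs (l : List V) (φ : V → ℂ) : V → ℂ :=
  l.foldr (fun v g x => fderiv ℝ g x v) φ

@[simp] theorem dirDerivs_nil (φ : V → ℂ) : dirDerivs [] φ = φ := rfl

theorem dirDerivs_cons (v : V) (l : List V) (φ : V → ℂ) :
    dirDerivs (v :: l) φ = fun x => fderiv ℝ (dirDerivs l φ) x v := rfl

theorem dirDerivs_append (l l' : List V) (φ : V → ℂ) :
    dirDerivs (l ++ l') φ = dirDerivs l (dirDerivs l' φ) := by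
  simp [dirDerivs, List.foldr_append]

theorem contDiff_dirDerivs {φ : V → ℂ} (h : ContDiff ℝ ∞ φ) (l : List V) :
    ContDiff ℝ ∞ (dirDerivs l φ) := by
  induction l with
  | nil => exact h
  | cons v l ih => exact (ih.fderiv_right (by simp)).clm_apply contDiff_const

theorem hasCompactSupport_dirDerivs {φ : V → ℂ} (h : HasCompactSupport φ) (l : List V) :
    HasCompactSupport (dirDerivs l φ) := by
  induction l with
  | nil => exact h
  | cons v l ih => exact ih.fderiv_apply ℝ v

theorem dirDerivs_sub {φ ψ : V → ℂ} (h : ContDiff ℝ ∞ φ) (h' : ContDiff ℝ ∞ ψ) (l : List V) :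
    dirDerivs l (φ - ψ) = dirDerivs l φ - dirDerivs l ψ := by
  induction l with
  | nil => rfl
  | cons v l ih =>
    funext x
    rw [dirDerivs_cons, ih]
    change fderiv ℝ (dirDerivs l φ - dirDerivs l ψ) x v = _
    rw [fderiv_sub ((contDiff_dirDerivs h l).differentiable (by simp) x)
      ((contDiff_dirDerivs h' l).differentiable (by simp) x)]
    rfl

theorem dirDerivs_map_smul (l : List V) (r : ℝ) (φ : V → ℂ) :
    dirDerivs (l.map (r • ·)) φ = (r ^ l.length) • dirDerivs l φ := by
  induction l with
  | nil => simp
  | cons v l ih =>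
    funext x
    rw [List.map_cons, dirDerivs_cons, ih, fderiv_const_smul_field]
    simp [dirDerivs_cons, pow_succ, mul_smul, mul_comm]

theorem dirDerivs_comp_affine {W : Type*} [NormedAddCommGroup W] [InnerProductSpace ℝ W]
    [FiniteDimensional ℝ W] [MeasurableSpace W] [BorelSpace W]
    (A : W →L[ℝ] V) (b : V) {φ : V → ℂ} (h : ContDiff ℝ ∞ φ) (l : List W) :
    dirDerivs l (fun x => φ (b + A x)) = fun x => dirDerivs (l.map A) φ (b + A x) := by
  induction l with
  | nil => rfl
  | cons v l ih =>
    funext x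
    have h1 : HasFDerivAt (fun x => b + A x) A x := A.hasFDerivAt.const_add b
    have h2 := ((contDiff_dirDerivs h (l.map A)).differentiable (by simp) (b + A x)).hasFDerivAt
    rw [dirDerivs_cons, ih]
    change fderiv ℝ (dirDerivs (l.map A) φ ∘ fun x => b + A x) x v = _
    rw [(h2.comp x h1).fderiv]
    rfl

/-- Each integration by parts strips the outermost direction from `φ` and applies it first to `f`;
hence the reversed list, and no commutation of derivatives is needed. -/
theorem integral_mul_dirDerivs {f φ : V → ℂ} (hf : ContDiff ℝ ∞ f) (hφ : ContDiff ℝ ∞ φ)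
    (hs : HasCompactSupport φ) (l : List V) :
    ∫ x, f x * dirDerivs l φ x = (-1) ^ l.length * ∫ x, dirDerivs l.reverse f x * φ x := by
  induction l generalizing f with
  | nil => simp
  | cons v l ih =>
    have hg := contDiff_dirDerivs hφ l
    have hgs := hasCompactSupport_dirDerivs hs l
    have hf' : ContDiff ℝ ∞ fun x => fderiv ℝ f x v :=
      (hf.fderiv_right (by simp)).clm_apply contDiff_const
    have hg' : ContDiff ℝ ∞ fun x => fderiv ℝ (dirDerivs l φ) x v :=
      (hg.fderiv_right (by simp)).clm_apply contDiff_const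
    have e := integral_mul_fderiv_eq_neg_fderiv_mul_of_integrable (μ := (volume : Measure V))
      (f := f) (g := dirDerivs l φ) (v := v)
      ((hf'.continuous.mul hg.continuous).integrable_of_hasCompactSupport hgs.mul_left)
      ((hf.continuous.mul hg'.continuous).integrable_of_hasCompactSupport
        (hgs.fderiv_apply ℝ v).mul_left)
      ((hf.continuous.mul hg.continuous).integrable_of_hasCompactSupport hgs.mul_left)
      (fun x _ => hf.differentiable (by simp) x) (fun x _ => hg.differentiable (by simp) x)
    rw [dirDerivs_cons, e, ih hf', List.reverse_cons, dirDerivs_append, List.length_cons, pow_succ]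
    simp only [mul_neg, mul_one, neg_mul]
    rfl

theorem enorm_fourier_dirDerivs_le {φ : V → ℂ} (hφ : ContDiff ℝ ∞ φ)
    (hs : HasCompactSupport φ) {l : List V} (hl : ∀ v ∈ l, ‖v‖ ≤ 1) (ξ : V) :
    ‖𝓕 (dirDerivs l φ) ξ‖ ≤ (2 * Real.pi * ‖ξ‖) ^ l.length * ‖𝓕 φ ξ‖ := by
  induction l with
  | nil => simp
  | cons v l ih =>
    set g := (hasCompactSupport_dirDerivs hs l).toSchwartzMap (contDiff_dirDerivs hφ l) with hg
    have e1 : 𝓕 (dirDerivs (v :: l) φ) ξ = (𝓕 (LineDeriv.lineDerivOp v g) : SchwartzMap V ℂ) ξ := by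
      rw [SchwartzMap.fourier_coe]
      congr 1
    have ht : (inner ℝ · v : V → ℝ).HasTemperateGrowth := ((innerSL ℝ).flip v).hasTemperateGrowth
    rw [e1, SchwartzMap.fourier_lineDerivOp_eq, smul_apply,
      SchwartzMap.smulLeftCLM_apply_apply ht, norm_smul, norm_smul, SchwartzMap.fourier_coe]
    have e2 : ‖(2 * Real.pi * Complex.I : ℂ)‖ = 2 * Real.pi := by
      simp [Real.pi_pos.le]
    have e3 : ‖(inner ℝ ξ v : ℝ)‖ ≤ ‖ξ‖ := by
      refine (norm_inner_le_norm ξ v).trans ?_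
      exact mul_le_of_le_one_right (norm_nonneg _) (hl v (by simp))
    have ih' := ih fun v hv => hl v (by simp [hv])
    rw [e2, List.length_cons, pow_succ', ← mul_assoc, mul_assoc _ _ ‖𝓕 φ ξ‖]
    refine mul_le_mul ?_ ih' (norm_nonneg _) (by positivity)
    gcongr

/-- By Plancherel this reduces to `t^{2⌊s⌋} ≤ 1 + t^{2s}`, which holds for `t ≤ 1` and for `t ≥ 1`
because `⌊s⌋ ≤ s`. -/
theorem lintegral_dirDerivs_sq_le {s : ℝ} (hs0 : 0 ≤ s) {φ : V → ℂ} (hφ : ContDiff ℝ ∞ φ)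
    (hs : HasCompactSupport φ) {l : List V} (hl : ∀ v ∈ l, ‖v‖ ≤ 1) (hm : l.length = ⌊s⌋₊) :
    ∫⁻ x, ‖dirDerivs l φ x‖ₑ ^ 2 ≤ sobolevIntegral s φ := by
  have hc := (contDiff_dirDerivs hφ l).continuous
  have hsl := hasCompactSupport_dirDerivs hs l
  rw [← lintegral_fourier_sq (hc.integrable_of_hasCompactSupport hsl)
    (hc.memLp_of_hasCompactSupport hsl)]
  refine lintegral_mono fun ξ => ?_
  have h1 := enorm_fourier_dirDerivs_le hφ hs hl ξ
  set t := 2 * Real.pi * ‖ξ‖ with ht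
  have ht0 : 0 ≤ t := by positivity
  have h2 : (t ^ l.length) ^ 2 ≤ 1 + t ^ (2 * s) := by
    rw [← pow_mul, hm]
    have hfl : ((⌊s⌋₊ : ℕ) : ℝ) ≤ s := Nat.floor_le hs0
    rcases le_total t 1 with h | h
    · have := pow_le_one₀ (n := ⌊s⌋₊ * 2) ht0 h
      have : 0 ≤ t ^ (2 * s) := by positivity
      linarith
    · rw [← Real.rpow_natCast]
      have := Real.rpow_le_rpow_of_exponent_le h
        (show ((⌊s⌋₊ * 2 : ℕ) : ℝ) ≤ 2 * s by push_cast; linarith)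
      linarith
  have h3 : ‖𝓕 (dirDerivs l φ) ξ‖ₑ ≤ ENNReal.ofReal (t ^ l.length) * ‖𝓕 φ ξ‖ₑ := by
    rw [← ofReal_norm, ← ofReal_norm, ← ENNReal.ofReal_mul (by positivity)]
    exact ENNReal.ofReal_le_ofReal h1
  refine (pow_le_pow_left' h3 2).trans ?_
  rw [mul_pow, ← ENNReal.ofReal_pow (by positivity)]
  gcongr
  rw [sobolevWeight, ← ENNReal.ofReal_one, ← ENNReal.ofReal_add zero_le_one (by positivity)]
  exact ENNReal.ofReal_le_ofReal h2

theorem tendsto_integral_mul {α : Type*} [MeasurableSpace α] {μ : Measure α} {u ψ : α → ℂ}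
    {φ : ℕ → α → ℂ} (hu : MemLp u 2 μ) (hφ : ∀ m, MemLp (φ m) 2 μ) (hψ : MemLp ψ 2 μ)
    (h : Filter.Tendsto (fun m => ∫⁻ x, ‖u x - φ m x‖ₑ ^ 2 ∂μ) Filter.atTop (nhds 0)) :
    Filter.Tendsto (fun m => ∫ x, φ m x * ψ x ∂μ) Filter.atTop (nhds (∫ x, u x * ψ x ∂μ)) := by
  have h1 : Filter.Tendsto (fun m => (hφ m).toLp (φ m)) Filter.atTop (nhds (hu.toLp u)) := by
    refine tendsto_of_lintegral_sub_sq (h.congr fun m => lintegral_congr_ae ?_)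
    filter_upwards [hu.coeFn_toLp, (hφ m).coeFn_toLp] with x h1 h2
    rw [h1, h2]
  have hψ' : MemLp (fun x => (starRingEnd ℂ) (ψ x)) 2 μ := hψ.star
  have key : ∀ {f : α → ℂ} (hf : MemLp f 2 μ),
      inner ℂ (hψ'.toLp _) (hf.toLp f) = ∫ x, f x * ψ x ∂μ := fun {f} hf => by
    rw [L2.inner_def]
    refine integral_congr_ae ?_
    filter_upwards [hψ'.coeFn_toLp, hf.coeFn_toLp] with x h1 h2
    rw [h1, h2]
    simp [mul_comm]
  have h2 := (continuous_const.inner continuous_id :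
    Continuous fun w : Lp ℂ 2 μ => inner ℂ (hψ'.toLp _) w).tendsto (hu.toLp u) |>.comp h1
  rw [← key hu]
  exact h2.congr fun m => key (hφ m)

end DirDerivs

/-! ### Weak derivatives: limits, uniqueness, scaling. -/

section WeakDeriv

variable {d : ℕ}

/-- The coordinate directions of the partial derivatives in `D^α`. -/
noncomputable def multiDirs (α : Fin d → ℕ) : List (Pos d) :=
  (List.finRange d).flatMap fun i => List.replicate (α i) (EuclideanSpace.single i 1)

theorem length_multiDirs (α : Fin d → ℕ) : (multiDirs α).length = ∑ i, α i := by
  rw [multiDirs, List.length_flatMap, Fin.sum_univ_def]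
  simp

theorem norm_le_of_mem_multiDirs {α : Fin d → ℕ} {v : Pos d} (h : v ∈ multiDirs α) :
    ‖v‖ ≤ 1 := by
  simp only [multiDirs, List.mem_flatMap] at h
  obtain ⟨i, -, hi⟩ := h
  rw [List.eq_of_mem_replicate hi]
  simp

theorem multiDeriv_eq_dirDerivs (α : Fin d → ℕ) (f : Pos d → ℂ) :
    multiDeriv α f = dirDerivs (multiDirs α) f := by
  have hrep : ∀ (i : Fin d) (n : ℕ) (g : Pos d → ℂ),
      (partialDeriv i)^[n] g = dirDerivs (List.replicate n (EuclideanSpace.single i 1)) g := by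
    intro i n g
    induction n with
    | zero => rfl
    | succ n ih =>
      rw [Function.iterate_succ_apply', ih, List.replicate_succ, dirDerivs_cons]
      rfl
  have : ∀ l : List (Fin d), l.foldr (fun i g => (partialDeriv i)^[α i] g) f =
      dirDerivs (l.flatMap fun i => List.replicate (α i) (EuclideanSpace.single i 1)) f := by
    intro l
    induction l with
    | nil => rfl
    | cons i l ih => rw [List.foldr_cons, ih, hrep, List.flatMap_cons, dirDerivs_append]
  exact this _

/-- The defining identity holds for each `φ m` by parts, and both of its sides are continuous in
`L²`. -/
theorem isWeakDeriv_of_tendsto {α : Fin d → ℕ} {u g : Pos d → ℂ} {φ : ℕ → Pos d → ℂ}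
    (hu : MemLp u 2) (hg : MemLp g 2) (hφ : ∀ m, ContDiff ℝ ∞ (φ m))
    (hs : ∀ m, HasCompactSupport (φ m))
    (h1 : Filter.Tendsto (fun m => ∫⁻ x, ‖u x - φ m x‖ₑ ^ 2) Filter.atTop (nhds 0))
    (h2 : Filter.Tendsto (fun m => ∫⁻ x, ‖g x - dirDerivs (multiDirs α).reverse (φ m) x‖ₑ ^ 2)
      Filter.atTop (nhds 0)) : IsWeakDeriv α u g := by
  refine ⟨hu.locallyIntegrable (by norm_num), hg.locallyIntegrable (by norm_num),
    fun ψ hψ hψs => ?_⟩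
  have hmem : ∀ {f : Pos d → ℂ}, ContDiff ℝ ∞ f → HasCompactSupport f → MemLp f 2 :=
    fun hf hfs => hf.continuous.memLp_of_hasCompactSupport hfs
  rw [multiDeriv_eq_dirDerivs, ← length_multiDirs]
  have t1 := tendsto_integral_mul hu (fun m => hmem (hφ m) (hs m))
    (hmem (contDiff_dirDerivs hψ (multiDirs α)) (hasCompactSupport_dirDerivs hψs _)) h1
  have t2 := tendsto_integral_mul hg (fun m => hmem (contDiff_dirDerivs (hφ m) _)
    (hasCompactSupport_dirDerivs (hs m) _)) (hmem hψ hψs) h2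
  refine tendsto_nhds_unique t1 ((t2.const_mul _).congr fun m => ?_)
  exact (integral_mul_dirDerivs (hφ m) hψ hψs _).symm

theorem IsWeakDeriv.ae_eq {α : Fin d → ℕ} {u g g' : Pos d → ℂ} (h : IsWeakDeriv α u g)
    (h' : IsWeakDeriv α u g') : g =ᵐ[volume] g' := by
  refine ae_eq_of_integral_contDiff_smul_eq h.2.1 h'.2.1 fun ψ hψ hs => ?_
  have hs₁ : HasCompactSupport (Complex.ofRealCLM ∘ ψ) := hs.comp_left rfl
  have hψ₁ : ContDiff ℝ ∞ (Complex.ofRealCLM ∘ ψ) := by fun_prop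
  have e1 := h.2.2 _ hψ₁ hs₁
  rw [h'.2.2 _ hψ₁ hs₁] at e1
  have e2 := mul_left_cancel₀ (pow_ne_zero _ (by norm_num)) e1
  simpa [mul_comm] using e2.symm

theorem IsWeakDeriv.congr_left {α : Fin d → ℕ} {u u' g : Pos d → ℂ} (h : IsWeakDeriv α u g)
    (hu : u =ᵐ[volume] u') : IsWeakDeriv α u' g := by
  refine ⟨h.1.congr hu, h.2.1, fun φ hφ hs => ?_⟩
  rw [← h.2.2 φ hφ hs]
  refine integral_congr_ae ?_
  filter_upwards [hu] with x hx
  rw [hx]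

theorem IsWeakDeriv.const_mul {α : Fin d → ℕ} {u g : Pos d → ℂ} (h : IsWeakDeriv α u g) (c : ℂ) :
    IsWeakDeriv α (fun x => c * u x) (fun x => c * g x) := by
  refine ⟨h.1.smul c, h.2.1.smul c, fun φ hφ hs => ?_⟩
  simp only [mul_assoc, integral_const_mul]
  rw [h.2.2 φ hφ hs]
  ring

theorem integral_comp_affine (f : Pos d → ℂ) (a : Pos d) {r : ℝ} (hr : 0 < r) :
    ∫ x, f (a + r • x) = ((r ^ d)⁻¹ : ℝ) * ∫ x, f x := by
  rw [Measure.integral_comp_smul volume (fun x => f (a + x)) r,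
    integral_add_left_eq_self (μ := volume) f a, abs_of_pos (by positivity),
    finrank_euclideanSpace_fin, Complex.real_smul]

theorem locallyIntegrable_comp_affine {f : Pos d → ℂ} (hf : LocallyIntegrable f) (a : Pos d)
    {r : ℝ} (hr : 0 < r) : LocallyIntegrable fun x => f (a + r • x) := by
  let e : Pos d ≃ₜ Pos d := (Homeomorph.smulOfNeZero r hr.ne').trans (Homeomorph.addLeft a)
  refine (locallyIntegrable_map_homeomorph e (f := f)).1 ?_
  have hm : Measure.map e volume =
      ENNReal.ofReal |(r ^ Module.finrank ℝ (Pos d))⁻¹| • (volume : Measure (Pos d)) := by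
    have : (e : Pos d → Pos d) = (fun x => a + x) ∘ (fun x => r • x) := rfl
    rw [this, ← Measure.map_map (by fun_prop) (by fun_prop), Measure.map_addHaar_smul _ hr.ne',
      Measure.map_smul, map_add_left_eq_self]
  rw [hm]
  intro x
  obtain ⟨U, hU, hU'⟩ := hf x
  refine ⟨U, hU, ?_⟩
  rw [IntegrableOn, Measure.restrict_smul]
  exact hU'.smul_measure (by simp)

/-- The test function is carried along by the inverse map, and the chain rule on it yields one
factor `r` per derivative. -/
theorem IsWeakDeriv.comp_affine {α : Fin d → ℕ} {u g : Pos d → ℂ} (h : IsWeakDeriv α u g)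
    (a : Pos d) {r : ℝ} (hr : 0 < r) :
    IsWeakDeriv α (fun x => u (a + r • x))
      (fun x => ((r ^ ∑ i, α i : ℝ) : ℂ) * g (a + r • x)) := by
  refine ⟨locallyIntegrable_comp_affine h.1 a hr,
    (locallyIntegrable_comp_affine h.2.1 a hr).smul ((r ^ ∑ i, α i : ℝ) : ℂ), fun φ hφ hs => ?_⟩
  set A : Pos d →L[ℝ] Pos d := r⁻¹ • ContinuousLinearMap.id ℝ (Pos d) with hA
  set b : Pos d := -(r⁻¹ • a) with hb
  set ψ : Pos d → ℂ := fun x => φ (b + A x) with hψ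
  have hinv : ∀ x, b + A (a + r • x) = x := fun x => by
    simp [hA, hb, smul_smul, hr.ne']
  have hψ1 : ContDiff ℝ ∞ ψ := hφ.comp (contDiff_const.add A.contDiff)
  have hψ2 : HasCompactSupport ψ :=
    hs.comp_homeomorph ((Homeomorph.smulOfNeZero r⁻¹ (inv_ne_zero hr.ne')).trans
      (Homeomorph.addLeft b))
  have e1 : ∀ x, multiDeriv α φ x =
      ((r ^ ∑ i, α i : ℝ) : ℂ) * multiDeriv α ψ (a + r • x) := fun x => by
    rw [multiDeriv_eq_dirDerivs, multiDeriv_eq_dirDerivs, hψ, dirDerivs_comp_affine A b hφ]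
    have : (multiDirs α).map A = (multiDirs α).map (r⁻¹ • ·) := rfl
    rw [this, dirDerivs_map_smul]
    beta_reduce
    rw [hinv, length_multiDirs, Pi.smul_apply, Complex.real_smul,
      ← mul_assoc, ← Complex.ofReal_mul, ← mul_pow, mul_inv_cancel₀ hr.ne']
    simp
  have e2 : ∀ x, φ x = ψ (a + r • x) := fun x => by rw [hψ]; simp only [hinv]
  simp only [e1]
  conv_rhs => simp only [e2]
  have h1 := integral_comp_affine
    (fun y => u y * (((r ^ ∑ i, α i : ℝ) : ℂ) * multiDeriv α ψ y)) a hr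
  have h2 := integral_comp_affine
    (fun y => ((r ^ ∑ i, α i : ℝ) : ℂ) * g y * ψ y) a hr
  rw [h1, h2]
  simp only [mul_left_comm (u _), mul_assoc, integral_const_mul]
  rw [h.2.2 ψ hψ1 hψ2]
  ring

end WeakDeriv

/-! ### The Neumann energy: invariance, scaling, measurability. -/

section Neumann

variable {d : ℕ}

theorem fracEnergy_congr (σ : ℝ) (Ω : Set (Pos d)) {g g' : Pos d → ℂ} (h : g =ᵐ[volume] g') :
    fracEnergy σ Ω g = fracEnergy σ Ω g' := by
  have h' := ae_restrict_of_ae (s := Ω) h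
  unfold fracEnergy
  split_ifs
  · exact lintegral_congr_ae (h'.mono fun x hx => by simp only [hx])
  · congr 1
    refine lintegral_congr_ae (h'.mono fun x hx => ?_)
    exact lintegral_congr_ae (h'.mono fun y hy => by simp only [hx, hy])

theorem fracEnergy_congr_set (σ : ℝ) {Ω Ω' : Set (Pos d)} (h : Ω =ᵐ[volume] Ω') (g : Pos d → ℂ) :
    fracEnergy σ Ω g = fracEnergy σ Ω' g := by
  unfold fracEnergy
  rw [Measure.restrict_congr_set h]

theorem fracEnergy_const_mul (σ : ℝ) (Ω : Set (Pos d)) (c : ℂ) (g : Pos d → ℂ) :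
    fracEnergy σ Ω (fun x => c * g x) = ‖c‖ₑ ^ 2 * fracEnergy σ Ω g := by
  have hc : ‖c‖ₑ ^ 2 ≠ ⊤ := by finiteness
  unfold fracEnergy
  split_ifs
  · simp only [enorm_mul, mul_pow, lintegral_const_mul' _ _ hc]
  · simp only [← mul_sub, enorm_mul, mul_pow, mul_div_assoc, lintegral_const_mul' _ _ hc]
    rw [mul_left_comm]

theorem setLIntegral_comp_affine (f : Pos d → ℝ≥0∞) (a : Pos d) {r : ℝ} (hr : 0 < r)
    {Q : Set (Pos d)} (hQ : MeasurableSet Q) :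
    ∫⁻ x in (fun x => a + r • x) ⁻¹' Q, f (a + r • x) =
      ENNReal.ofReal ((r ^ d)⁻¹) * ∫⁻ x in Q, f x := by
  rw [← lintegral_indicator hQ, ← lintegral_indicator (hQ.preimage (by fun_prop))]
  have := lintegral_comp_affine volume (Q.indicator f) a hr
  rw [finrank_euclideanSpace_fin] at this
  exact this

/-- Two volume factors `r^{-d}` and one kernel factor `r^{d+2σ}` make `r^{2σ-d}`; for `σ = 0` the
single volume factor `r^{-d}` fits the same formula. -/
theorem fracEnergy_comp_affine {σ : ℝ} (a : Pos d) {r : ℝ} (hr : 0 < r)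
    {Q : Set (Pos d)} (hQ : MeasurableSet Q) (g : Pos d → ℂ) :
    fracEnergy σ ((fun x => a + r • x) ⁻¹' Q) (fun x => g (a + r • x)) =
      ENNReal.ofReal (r ^ (2 * σ - d)) * fracEnergy σ Q g := by
  unfold fracEnergy
  split_ifs with h
  · rw [setLIntegral_comp_affine (fun x => ‖g x‖ₑ ^ 2) a hr hQ, h]
    simp [Real.rpow_neg hr.le]
  · set c := ENNReal.ofReal ((r ^ d)⁻¹) with hc
    set p : ℝ := d + 2 * σ with hp
    have h1 : ∀ x y : Pos d, ‖g (a + r • x) - g (a + r • y)‖ₑ ^ 2 / ‖x - y‖ₑ ^ p =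
        ENNReal.ofReal (r ^ p) *
          (‖g (a + r • x) - g (a + r • y)‖ₑ ^ 2 / ‖(a + r • x) - (a + r • y)‖ₑ ^ p) := by
      intro x y
      have hr0 : ENNReal.ofReal (r ^ p) ≠ 0 := by
        simpa using Real.rpow_pos_of_pos hr p
      rw [add_sub_add_left_eq_sub, ← smul_sub, enorm_smul, Real.enorm_eq_ofReal hr.le,
        ENNReal.mul_rpow_of_ne_top (by simp) (by simp), ENNReal.ofReal_rpow_of_pos hr,
        div_eq_mul_inv, div_eq_mul_inv, ENNReal.mul_inv (Or.inl hr0) (Or.inl (by simp)),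
        mul_left_comm, ← mul_assoc (ENNReal.ofReal (r ^ p)), ENNReal.mul_inv_cancel hr0 (by simp),
        one_mul]
    have h2 : ∀ x : Pos d, ∫⁻ y in (fun x => a + r • x) ⁻¹' Q,
        ‖g (a + r • x) - g (a + r • y)‖ₑ ^ 2 / ‖x - y‖ₑ ^ p =
        ENNReal.ofReal (r ^ p) * c *
          ∫⁻ y in Q, ‖g (a + r • x) - g y‖ₑ ^ 2 / ‖(a + r • x) - y‖ₑ ^ p := by
      intro x
      simp only [h1]
      rw [lintegral_const_mul' _ _ (by simp), setLIntegral_comp_affine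
        (fun y => ‖g (a + r • x) - g y‖ₑ ^ 2 / ‖(a + r • x) - y‖ₑ ^ p) a hr hQ, mul_assoc]
    have h3 : ENNReal.ofReal (r ^ p) * c * c = ENNReal.ofReal (r ^ (2 * σ - d)) := by
      rw [hc, ← ENNReal.ofReal_mul (by positivity), ← ENNReal.ofReal_mul (by positivity)]
      congr 1
      rw [← Real.rpow_natCast, ← Real.rpow_neg hr.le, ← Real.rpow_add hr, ← Real.rpow_add hr, hp]
      congr 1
      ring
    simp only [h2]
    rw [lintegral_const_mul' _ _ (by finiteness), setLIntegral_comp_affine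
      (fun x => ∫⁻ y in Q, ‖g x - g y‖ₑ ^ 2 / ‖x - y‖ₑ ^ p) a hr hQ, ← h3]
    ring

theorem iInf_fracEnergy_eq {α : Fin d → ℕ} {u g : Pos d → ℂ} (h : IsWeakDeriv α u g) (σ : ℝ)
    (Ω : Set (Pos d)) :
    ⨅ (g : Pos d → ℂ) (_ : IsWeakDeriv α u g), fracEnergy σ Ω g = fracEnergy σ Ω g :=
  le_antisymm (iInf₂_le g h) (le_iInf₂ fun _ h' => (fracEnergy_congr σ Ω (h.ae_eq h')).le)

theorem neumannSq_congr (s : ℝ) (Ω : Set (Pos d)) {u u' : Pos d → ℂ} (h : u =ᵐ[volume] u') :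
    neumannSq s Ω u = neumannSq s Ω u' := by
  have : ∀ (α : Fin d → ℕ) g, IsWeakDeriv α u g ↔ IsWeakDeriv α u' g := fun α g =>
    ⟨fun H => H.congr_left h, fun H => H.congr_left h.symm⟩
  simp only [neumannSq, this]

theorem neumannSq_congr_set (s : ℝ) {Ω Ω' : Set (Pos d)} (h : Ω =ᵐ[volume] Ω') (u : Pos d → ℂ) :
    neumannSq s Ω u = neumannSq s Ω' u := by
  simp only [neumannSq, fracEnergy_congr_set _ h]

/-- The comparison is made for each competitor of each infimum. `K ≠ 0` matters: without a weak
derivative the infimum is `⊤`, and `0 * ⊤ = 0`. -/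
theorem neumannSq_le_of_forall {s : ℝ} {Ω Ω' : Set (Pos d)} {u u' : Pos d → ℂ} {K : ℝ≥0∞}
    (hK0 : K ≠ 0) (hK : K ≠ ⊤)
    (h : ∀ (α : Fin d → ℕ) (g : Pos d → ℂ), ∑ i, α i = ⌊s⌋₊ → IsWeakDeriv α u g →
      ∃ g', IsWeakDeriv α u' g' ∧ fracEnergy (s - ⌊s⌋₊) Ω' g' ≤ K * fracEnergy (s - ⌊s⌋₊) Ω g) :
    neumannSq s Ω' u' ≤ K * neumannSq s Ω u := by
  rw [neumannSq, neumannSq, Finset.mul_sum]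
  refine Finset.sum_le_sum fun α hα => ?_
  have hα' : ∑ i, α i = ⌊s⌋₊ := (Finset.mem_piAntidiag.1 hα).1
  rw [mul_left_comm]
  gcongr
  rw [ENNReal.mul_iInf_of_ne hK0 hK]
  refine le_iInf fun g => ?_
  rw [ENNReal.mul_iInf_of_ne hK0 hK]
  refine le_iInf fun hg => ?_
  obtain ⟨g', h1, h2⟩ := h α g hα' hg
  exact iInf₂_le_of_le g' h1 h2

theorem neumannSq_const_mul_le (s : ℝ) (Ω : Set (Pos d)) (u : Pos d → ℂ) {c : ℂ} (hc : c ≠ 0) :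
    neumannSq s Ω (fun x => c * u x) ≤ ‖c‖ₑ ^ 2 * neumannSq s Ω u :=
  neumannSq_le_of_forall (by simpa using hc) (by finiteness) fun _ g _ hg =>
    ⟨_, hg.const_mul c, (fracEnergy_const_mul _ _ c g).le⟩

theorem neumannSq_comp_affine_le (s : ℝ) (a : Pos d) {r : ℝ} (hr : 0 < r)
    {Q : Set (Pos d)} (hQ : MeasurableSet Q) (u : Pos d → ℂ) :
    neumannSq s ((fun x => a + r • x) ⁻¹' Q) (fun x => u (a + r • x)) ≤
      ENNReal.ofReal (r ^ (2 * s - d)) * neumannSq s Q u := by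
  refine neumannSq_le_of_forall ?_ (by simp) fun α g hα hg => ⟨_, hg.comp_affine a hr, le_of_eq ?_⟩
  · simpa using Real.rpow_pos_of_pos hr _
  -- The derivatives give `r^{2⌊s⌋}` and the energy `r^{2(s-⌊s⌋)-d}`; the product is `r^{2s-d}`, the
  -- same for all `α`.
  · rw [fracEnergy_const_mul, fracEnergy_comp_affine a hr hQ, ← mul_assoc]
    congr 1
    rw [← ofReal_norm, Complex.norm_real, Real.norm_of_nonneg (by positivity),
      ← ENNReal.ofReal_pow (by positivity), ← ENNReal.ofReal_mul (by positivity), hα, ← pow_mul,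
      ← Real.rpow_natCast, ← Real.rpow_add hr]
    congr 2
    push_cast
    ring

theorem measurable_fracEnergy {Y : Type*} [MeasurableSpace Y] (σ : ℝ) (Ω : Set (Pos d))
    {G : Y → Pos d → ℂ} (hG : Measurable (Function.uncurry G)) :
    Measurable fun z => fracEnergy σ Ω (G z) := by
  unfold fracEnergy
  split_ifs
  · exact Measurable.lintegral_prod_right' (ν := volume.restrict Ω)
      (f := fun p : Y × Pos d => ‖G p.1 p.2‖ₑ ^ 2) (hG.enorm.pow_const 2)
  · refine Measurable.const_mul ?_ _
    refine Measurable.lintegral_prod_right' (ν := volume.restrict Ω)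
      (f := fun p : Y × Pos d => ∫⁻ y in Ω, ‖G p.1 p.2 - G p.1 y‖ₑ ^ 2 /
        ‖p.2 - y‖ₑ ^ ((d : ℝ) + 2 * σ)) ?_
    refine Measurable.lintegral_prod_right' (ν := volume.restrict Ω)
      (f := fun p : (Y × Pos d) × Pos d => ‖G p.1.1 p.1.2 - G p.1.1 p.2‖ₑ ^ 2 /
        ‖p.1.2 - p.2‖ₑ ^ ((d : ℝ) + 2 * σ)) ?_
    have h1 : Measurable fun p : (Y × Pos d) × Pos d => G p.1.1 p.1.2 := hG.comp measurable_fst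
    have h2 : Measurable fun p : (Y × Pos d) × Pos d => G p.1.1 p.2 :=
      hG.comp (f := fun p : (Y × Pos d) × Pos d => (p.1.1, p.2)) (by fun_prop)
    have h3 : Measurable fun p : (Y × Pos d) × Pos d => p.1.2 - p.2 := by fun_prop
    exact ((h1.sub h2).enorm.pow_const 2).div (h3.enorm.pow_const _)

end Neumann

/-! ### Weak derivatives and energies of slices. -/

section JoinInl

variable {X Y V : Type*}
  [NormedAddCommGroup X] [InnerProductSpace ℝ X] [FiniteDimensional ℝ X]
  [MeasurableSpace X] [BorelSpace X]
  [NormedAddCommGroup Y] [InnerProductSpace ℝ Y] [FiniteDimensional ℝ Y]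
  [MeasurableSpace Y] [BorelSpace Y]
  [NormedAddCommGroup V] [InnerProductSpace ℝ V] [FiniteDimensional ℝ V]
  [MeasurableSpace V] [BorelSpace V]
  (L : WithLp 2 (X × Y) ≃ₗᵢ[ℝ] V)

/-- The embedding of the first component of an orthogonal decomposition. -/
noncomputable def joinInl : X →L[ℝ] V :=
  LinearMap.toContinuousLinearMap
    { toFun := fun x => join L x 0
      map_add' := fun x y => by
        unfold join
        rw [← map_add]
        exact congrArg L (WithLp.ofLp_injective _ (Prod.ext rfl (add_zero _).symm))
      map_smul' := fun c x => by
        unfold join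
        rw [RingHom.id_apply, ← map_smul]
        exact congrArg L (WithLp.ofLp_injective _ (Prod.ext rfl (smul_zero _).symm)) }

theorem joinInl_apply (x : X) : joinInl L x = join L x 0 := rfl

theorem join_eq_add (x : X) (z : Y) : join L x z = join L 0 z + joinInl L x := by
  rw [joinInl_apply]
  unfold join
  rw [← map_add]
  exact congrArg L (WithLp.ofLp_injective _ (Prod.ext (zero_add _).symm (add_zero _).symm))

theorem norm_joinInl (x : X) : ‖joinInl L x‖ = ‖x‖ := by
  rw [joinInl_apply, ← sq_eq_sq₀ (norm_nonneg _) (norm_nonneg _), ← real_inner_self_eq_norm_sq,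
    inner_join, inner_zero_left, add_zero, real_inner_self_eq_norm_sq]

theorem contDiff_slice (a : X) (r : ℝ) {φ : V → ℂ} (hφ : ContDiff ℝ ∞ φ) (z : Y) :
    ContDiff ℝ ∞ (slice L a r φ z) := by
  have e : slice L a r φ z = fun x => φ (join L 0 z + joinInl L (a + r • x)) :=
    funext fun x => congrArg φ (join_eq_add L _ z)
  rw [e]
  exact hφ.comp (contDiff_const.add ((joinInl L).contDiff.comp
    (contDiff_const.add (contDiff_id.const_smul r))))

end JoinInl

section SliceDeriv

variable {d : ℕ} {Y V : Type*}
  [NormedAddCommGroup Y] [InnerProductSpace ℝ Y] [FiniteDimensional ℝ Y]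
  [MeasurableSpace Y] [BorelSpace Y]
  [NormedAddCommGroup V] [InnerProductSpace ℝ V] [FiniteDimensional ℝ V]
  [MeasurableSpace V] [BorelSpace V]
  (L : WithLp 2 (Pos d × Y) ≃ₗᵢ[ℝ] V)

theorem slice_zero_one (u : V → ℂ) (z : Y) : slice L 0 1 u z = fun x => u (join L x z) := by
  funext x
  simp [slice]

theorem slice_zero_one_eq (u : V → ℂ) (z : Y) :
    slice L 0 1 u z = fun x => u (join L 0 z + joinInl L x) := by
  rw [slice_zero_one]
  exact funext fun x => congrArg u (join_eq_add L x z)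

theorem dirDerivs_slice (l : List (Pos d)) {φ : V → ℂ} (hφ : ContDiff ℝ ∞ φ) (z : Y) :
    dirDerivs l (slice L 0 1 φ z) = slice L 0 1 (dirDerivs (l.map (joinInl L)) φ) z := by
  simp only [slice_zero_one_eq]
  exact dirDerivs_comp_affine (joinInl L) (join L 0 z) hφ l

/-- An `H^s` function has partial weak derivatives of order `⌊s⌋` on almost all slices, and they
are the slices of one function. -/
theorem exists_isWeakDeriv_slice {s : ℝ} (hs0 : 0 ≤ s) {α : Fin d → ℕ} (hα : ∑ i, α i = ⌊s⌋₊)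
    {u : Lp ℂ 2 (volume : Measure V)} {φ : ℕ → V → ℂ} (hc : ∀ m, ContDiff ℝ ∞ (φ m))
    (hs : ∀ m, HasCompactSupport (φ m)) {Φ : ℕ → Lp ℂ 2 (volume : Measure V)}
    (hΦ : ∀ m, Φ m =ᵐ[volume] φ m) (h : ∀ m, sobolevSq s (u - Φ m) ≤ 4⁻¹ ^ m) :
    ∃ G : Lp ℂ 2 (volume : Measure V), ∀ᵐ z : Y,
      IsWeakDeriv α (slice L 0 1 u z) (slice L 0 1 G z) := by
  set l := ((multiDirs α).reverse).map (joinInl L) with hl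
  have hl1 : ∀ v ∈ l, ‖v‖ ≤ 1 := fun v hv => by
    obtain ⟨w, hw, rfl⟩ := List.mem_map.1 hv
    rw [norm_joinInl]
    exact norm_le_of_mem_multiDirs (List.mem_reverse.1 hw)
  have hl2 : l.length = ⌊s⌋₊ := by simp [hl, length_multiDirs, hα]
  have hDm : ∀ m, MemLp (dirDerivs l (φ m)) 2 := fun m =>
    (contDiff_dirDerivs (hc m) l).continuous.memLp_of_hasCompactSupport
      (hasCompactSupport_dirDerivs (hs m) l)
  set D : ℕ → Lp ℂ 2 (volume : Measure V) := fun m => (hDm m).toLp _ with hD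
  -- The derivatives inherit the fast rate: squared distances are at most `4 * 4⁻¹ ^ m`, so the `D
  -- m` form a Cauchy sequence with limit `G`.
  have hstep : ∀ m, edist (D m) (D (m + 1)) ≤ 2 / 2 ^ m := fun m => by
    have e1 : ‖D m - D (m + 1)‖ₑ ^ 2 ≤ (2 / 2 ^ m) ^ 2 := by
      have e2 : ‖D m - D (m + 1)‖ₑ ^ 2 = ∫⁻ x, ‖dirDerivs l (φ m - φ (m + 1)) x‖ₑ ^ 2 := by
        rw [enorm_sq_eq_lintegral, dirDerivs_sub (hc m) (hc (m + 1))]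
        refine lintegral_congr_ae ?_
        filter_upwards [Lp.coeFn_sub (D m) (D (m + 1)), (hDm m).coeFn_toLp,
          (hDm (m + 1)).coeFn_toLp] with x h1 h2 h3
        rw [h1, Pi.sub_apply, Pi.sub_apply, hD, h2, h3]
      rw [e2]
      refine (lintegral_dirDerivs_sq_le hs0 ((hc m).sub (hc (m + 1))) ((hs m).sub (hs (m + 1)))
        hl1 hl2).trans ?_
      have hsub : (Φ m - Φ (m + 1) : Lp ℂ 2 (volume : Measure V)) =ᵐ[volume]
          φ m - φ (m + 1) := by
        filter_upwards [Lp.coeFn_sub (Φ m) (Φ (m + 1)), hΦ m, hΦ (m + 1)] with x h1 h2 h3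
        rw [h1, Pi.sub_apply, Pi.sub_apply, h2, h3]
      rw [← sobolevSq_eq_sobolevIntegral s (((hc m).sub (hc (m + 1))).continuous
        |>.integrable_of_hasCompactSupport ((hs m).sub (hs (m + 1)))) hsub]
      refine (sobolevSq_sub_le s _ _ u).trans ?_
      have h4 : (4⁻¹ : ℝ≥0∞) ^ (m + 1) ≤ 4⁻¹ ^ m :=
        pow_le_pow_right_of_le_one' (by simp) (Nat.le_succ m)
      calc 2 * (sobolevSq s (u - Φ (m + 1)) + sobolevSq s (u - Φ m))
          ≤ 2 * (4⁻¹ ^ m + 4⁻¹ ^ m) := by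
            gcongr
            · exact (h (m + 1)).trans h4
            · exact h m
        _ = 4 * 4⁻¹ ^ m := by ring
        _ = (2 / 2 ^ m) ^ 2 := by
            rw [div_eq_mul_inv, mul_pow, ← ENNReal.inv_pow, ← ENNReal.inv_pow, ← pow_mul,
              mul_comm m, pow_mul]
            norm_num
    rw [edist_eq_enorm_sub]
    exact (ENNReal.pow_le_pow_left_iff (by norm_num)).1 e1
  obtain ⟨G, hG⟩ := cauchySeq_tendsto_of_complete
    (cauchySeq_of_edist_le_geometric_two 2 (by norm_num) hstep)
  have hG' := edist_le_of_edist_le_geometric_two_of_tendsto 2 hstep hG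
  have hb : ∀ {c : ℝ≥0∞}, c ≠ ⊤ → ∑' m : ℕ, c * (4⁻¹ : ℝ≥0∞) ^ m ≠ ⊤ := fun {c} hc => by
    have : ∑' m : ℕ, (4⁻¹ : ℝ≥0∞) ^ m ≠ ⊤ := by
      rw [ENNReal.tsum_geometric, ENNReal.inv_ne_top]
      exact (tsub_pos_of_lt (by simp)).ne'
    rw [ENNReal.tsum_mul_left]
    finiteness
  have hA := ae_tendsto_slice_sub_sq L 0 one_pos (Lp.stronglyMeasurable u).measurable
    (fun m => (hc m).continuous.measurable) (hb (c := 1) (by simp)) fun m => by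
      rw [one_mul]
      refine le_trans (le_of_eq ?_) ((enorm_sq_le_sobolevSq s _).trans (h m))
      rw [enorm_sq_eq_lintegral]
      refine lintegral_congr_ae ?_
      filter_upwards [Lp.coeFn_sub u (Φ m), hΦ m] with x h1 h2
      rw [h1, Pi.sub_apply, h2]
  -- The geometric tail gives distance at most `4 / 2 ^ m` to the limit, and its square has the
  -- constant `16`.
  have hB := ae_tendsto_slice_sub_sq L 0 one_pos (Lp.stronglyMeasurable G).measurable
    (fun m => (contDiff_dirDerivs (hc m) l).continuous.measurable) (hb (c := 16) (by simp))
    fun m => by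
      have e1 : ∫⁻ x, ‖G x - dirDerivs l (φ m) x‖ₑ ^ 2 = ‖G - D m‖ₑ ^ 2 := by
        rw [enorm_sq_eq_lintegral]
        refine lintegral_congr_ae ?_
        filter_upwards [Lp.coeFn_sub G (D m), (hDm m).coeFn_toLp] with x h1 h2
        rw [h1, Pi.sub_apply, hD, h2]
      rw [e1, ← edist_eq_enorm_sub, edist_comm]
      refine (pow_le_pow_left' (hG' m) 2).trans (le_of_eq ?_)
      rw [div_eq_mul_inv, mul_pow, ← ENNReal.inv_pow, ← ENNReal.inv_pow, ← pow_mul, mul_comm m,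
        pow_mul]
      norm_num
  refine ⟨G, ?_⟩
  filter_upwards [hA, hB, ae_memLp_slice L 0 one_pos u, ae_memLp_slice L 0 one_pos G]
    with z h1 h2 h3 h4
  refine isWeakDeriv_of_tendsto h3 h4 (fun m => contDiff_slice L 0 1 (hc m) z)
    (fun m => hasCompactSupport_slice L 0 one_pos (hs m) z) h1 (h2.congr fun m => ?_)
  rw [dirDerivs_slice L _ (hc m)]

/-- An infimum over all weak derivatives is not visibly measurable in `z`. For almost every `z` it
equals the energy of a slice of one fixed measurable `G`. -/
theorem aemeasurable_neumannSq_slice {s : ℝ} (hs0 : 0 ≤ s) (Ω : Set (Pos d))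
    {u : Lp ℂ 2 (volume : Measure V)} {φ : ℕ → V → ℂ} (hc : ∀ m, ContDiff ℝ ∞ (φ m))
    (hs : ∀ m, HasCompactSupport (φ m)) {Φ : ℕ → Lp ℂ 2 (volume : Measure V)}
    (hΦ : ∀ m, Φ m =ᵐ[volume] φ m) (h : ∀ m, sobolevSq s (u - Φ m) ≤ 4⁻¹ ^ m) :
    AEMeasurable fun z : Y => neumannSq s Ω (slice L 0 1 u z) := by
  unfold neumannSq
  refine Finset.aemeasurable_fun_sum _ fun α hα => ?_
  obtain ⟨G, hG⟩ := exists_isWeakDeriv_slice L hs0 (Finset.mem_piAntidiag.1 hα).1 hc hs hΦ h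
  refine AEMeasurable.const_mul ?_ _
  refine ⟨fun z => fracEnergy (s - ⌊s⌋₊) Ω (slice L 0 1 G z),
    measurable_fracEnergy _ Ω (measurable_slice L 0 1 (Lp.stronglyMeasurable G).measurable), ?_⟩
  filter_upwards [hG] with z hz
  exact iInf_fracEnergy_eq hz _ _

end SliceDeriv

/-! ### Slices of functions vanishing on the diagonals. -/

section VanishingSpace

variable {d : ℕ} {ι ν κ : Type*} [Fintype ι] [Fintype ν] [Fintype κ]
  [DecidableEq ι] [DecidableEq ν] [DecidableEq κ]

/-- The rate `4⁻¹ ^ m` is summable, as the almost-everywhere arguments on slices require. -/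
theorem exists_fast_approximation {s : ℝ} {k : ℕ} {Ψ : WaveFn d ι}
    (h : Ψ ∈ vanishingSpace d ι s k) :
    ∃ (φ : ℕ → Config d ι → ℂ) (Φ : ℕ → WaveFn d ι), (∀ m, ContDiff ℝ ∞ (φ m)) ∧
      (∀ m, HasCompactSupport (φ m)) ∧ (∀ m, ∀ x ∈ diagonal d ι k, φ m x = 0) ∧
      (∀ m, Φ m =ᵐ[volume] φ m) ∧ ∀ m, sobolevSq s (Ψ - Φ m) ≤ 4⁻¹ ^ m := by
  have hm : ∀ m : ℕ, ∃ Φ ∈ vanishingTest d ι k, sobolevSq s (Ψ - Φ) < 4⁻¹ ^ m := fun m =>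
    h.2 _ (ENNReal.pow_pos (by simp) m)
  choose Φ hΦ hlt using hm
  choose φ h1 h2 h3 h4 using hΦ
  exact ⟨φ, Φ, h1, h2, h3, h4, fun m => (hlt m).le⟩

theorem smul_mem_vanishingSpace {s : ℝ} {k : ℕ} {Ψ : WaveFn d ι}
    (h : Ψ ∈ vanishingSpace d ι s k) {c : ℂ} (hc : c ≠ 0) : c • Ψ ∈ vanishingSpace d ι s k := by
  have hc1 : ‖c‖ₑ ^ 2 ≠ ⊤ := by finiteness
  have hc0 : ‖c‖ₑ ^ 2 ≠ 0 := by simpa using hc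
  refine ⟨by rw [sobolevSq_smul]; exact ENNReal.mul_lt_top hc1.lt_top h.1, fun ε hε => ?_⟩
  obtain ⟨Φ, ⟨φ, h1, h2, h3, h4⟩, hlt⟩ := h.2 (ε / ‖c‖ₑ ^ 2) (ENNReal.div_pos hε.ne' hc1)
  refine ⟨c • Φ, ⟨c • φ, h1.const_smul c, h2.smul_left (f := fun _ => c), fun x hx => ?_, ?_⟩, ?_⟩
  · simp [h3 x hx]
  · filter_upwards [Lp.coeFn_smul c Φ, h4] with x e1 e2
    rw [e1, Pi.smul_apply, e2, Pi.smul_apply]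
  · rw [← smul_sub, sobolevSq_smul, mul_comm]
    exact (ENNReal.lt_div_iff_mul_lt (Or.inl hc0) (Or.inl hc1)).1 hlt

/-- The configuration with all particles at one place. -/
noncomputable def constConfig (ν : Type*) [Fintype ν] (a : Pos d) : Config d ν :=
  WithLp.toLp 2 fun _ => a

/-- The affine map moves all particles of the group alike, so coincidences persist in the full
configuration; hence test functions restrict to test functions. -/
theorem join_mem_diagonal (e : ν ⊕ κ ≃ ι) (a : Pos d) (r : ℝ) {k : ℕ} {x : Config d ν}
    (hx : x ∈ diagonal d ν k) (z : Config d κ) :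
    join (glue d ν κ ι e) (constConfig ν a + r • x) z ∈ diagonal d ι k := by
  obtain ⟨j, hj⟩ := hx
  refine ⟨(j.trans Function.Embedding.inl).trans e.toEmbedding, fun p q => ?_⟩
  change join (glue d ν κ ι e) _ z (e (Sum.inl (j p))) =
    join (glue d ν κ ι e) _ z (e (Sum.inl (j q)))
  rw [join_glue_inl, join_glue_inl, PiLp.add_apply, PiLp.add_apply, PiLp.smul_apply,
    PiLp.smul_apply, hj p q]
  rfl

/-- Almost every slice with a group of particles fixed vanishes on the diagonals of the rest. -/
theorem ae_slice_mem_vanishingSpace (e : ν ⊕ κ ≃ ι) {s : ℝ} (hs0 : 0 ≤ s) {k : ℕ} {Ψ : WaveFn d ι}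
    (h : Ψ ∈ vanishingSpace d ι s k) (a : Pos d) {r : ℝ} (hr : 0 < r) :
    ∀ᵐ z : Config d κ, ∃ w ∈ vanishingSpace d ν s k,
      w =ᵐ[volume] slice (glue d ν κ ι e) (constConfig ν a) r Ψ z := by
  obtain ⟨φ, Φ, h1, h2, h3, h4, h5⟩ := exists_fast_approximation h
  have hfin : ∀ᵐ z : Config d κ, ∀ m,
      sobolevIntegral s (slice (glue d ν κ ι e) (constConfig ν a) r (φ m) z) < ⊤ := by
    refine ae_all_iff.2 fun m => ?_
    refine ae_lt_top (measurable_sobolevIntegral_slice (glue d ν κ ι e) s (constConfig ν a) r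
      (h1 m).continuous) (ne_top_of_le_ne_top ?_
        (lintegral_sobolevIntegral_slice_le (glue d ν κ ι e) hs0 (constConfig ν a) hr
          (h1 m).continuous (h2 m)))
    rw [← sobolevSq_eq_sobolevIntegral s
      ((h1 m).continuous.integrable_of_hasCompactSupport (h2 m)) (h4 m)]
    have e1 : sobolevSq s (Φ m) ≤ 2 * (sobolevSq s Ψ + sobolevSq s (Ψ - Φ m)) := by
      simpa using sobolevSq_sub_le s (Φ m) 0 Ψ
    have e2 : sobolevSq s (Φ m) ≠ ⊤ := by
      refine ne_top_of_le_ne_top ?_ e1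
      have := h.1.ne
      have := ne_top_of_le_ne_top (by finiteness) (h5 m)
      finiteness
    finiteness
  filter_upwards [ae_tendsto_sobolevSq_slice (glue d ν κ ι e) hs0 (constConfig ν a) hr
    (fun m => (h1 m).continuous) h2 h4 h5,
    ae_memLp_slice (glue d ν κ ι e) (constConfig ν a) hr Ψ, hfin]
    with z hz1 hz2 hz3
  have hcs : ∀ m, HasCompactSupport (slice (glue d ν κ ι e) (constConfig ν a) r (φ m) z) := fun m =>
    hasCompactSupport_slice (glue d ν κ ι e) _ hr (h2 m) z
  have hmem : ∀ m, MemLp (slice (glue d ν κ ι e) (constConfig ν a) r (φ m) z) 2 := fun m =>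
    (continuous_slice (glue d ν κ ι e) _ r (h1 m).continuous z).memLp_of_hasCompactSupport (hcs m)
  have ht := hz1 _ hz2.coeFn_toLp (fun m => (hmem m).toLp _) fun m => (hmem m).coeFn_toLp
  have htest : ∀ m, (hmem m).toLp _ ∈ vanishingTest d ν k := fun m =>
    ⟨_, contDiff_slice (glue d ν κ ι e) _ r (h1 m) z, hcs m,
      fun x hx => h3 m _ (join_mem_diagonal e a r hx z), (hmem m).coeFn_toLp⟩
  refine ⟨hz2.toLp _, ⟨?_, fun ε hε => ?_⟩, hz2.coeFn_toLp⟩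
  -- Finiteness of the norm of the slice follows by comparison with one approximant, which has
  -- finite norm by `hfin`.
  · obtain ⟨m, hm⟩ := (ht.eventually (gt_mem_nhds one_pos)).exists
    have h0 : sobolevSq s ((hmem m).toLp _) ≠ ⊤ := by
      rw [sobolevSq_eq_sobolevIntegral s ((continuous_slice (glue d ν κ ι e) _ r (h1 m).continuous
        z).integrable_of_hasCompactSupport (hcs m)) (hmem m).coeFn_toLp]
      exact (hz3 m).ne
    have e1 := sobolevSq_add_le s (hz2.toLp _ - (hmem m).toLp _) ((hmem m).toLp _)
    rw [sub_add_cancel] at e1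
    have := hm.ne_top
    exact lt_of_le_of_lt e1 (by finiteness)
  · obtain ⟨m, hm⟩ := (ht.eventually (gt_mem_nhds hε)).exists
    exact ⟨_, htest m, hm⟩

end VanishingSpace

/-! ### The energy of one block of particles. -/

section LocalEnergy

variable {d : ℕ} {ι ν κ : Type*} [Fintype ι] [Fintype ν] [Fintype κ]
  [DecidableEq ι] [DecidableEq ν] [DecidableEq κ]

theorem fullyLocalEnergy_congr (s : ℝ) (Ω : Set (Pos d)) {u u' : Config d ι → ℂ}
    (h : u =ᵐ[volume] u') : fullyLocalEnergy s Ω u = fullyLocalEnergy s Ω u' := by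
  refine Finset.sum_congr rfl fun j _ => lintegral_congr_ae (ae_restrict_of_ae ?_)
  refine ae_config (p := fun x' => neumannSq s Ω (fun y => u (insertAt j y x')) =
    neumannSq s Ω (fun y => u' (insertAt j y x'))) ?_
  filter_upwards [ae_ae_join (insertEquiv d ι j) h] with z hz
  exact neumannSq_congr s Ω hz

theorem fullyLocalEnergy_const_mul_le (s : ℝ) (Ω : Set (Pos d)) (u : Config d ι → ℂ) {c : ℂ}
    (hc : c ≠ 0) :
    fullyLocalEnergy s Ω (fun x => c * u x) ≤ ‖c‖ₑ ^ 2 * fullyLocalEnergy s Ω u := by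
  rw [fullyLocalEnergy, fullyLocalEnergy, Finset.mul_sum]
  refine Finset.sum_le_sum fun j _ => ?_
  rw [← lintegral_const_mul' _ _ (by finiteness)]
  exact lintegral_mono fun x' => neumannSq_const_mul_le s Ω _ hc

/-- The ground-state energy bounds the energy of functions that are not normalized. -/
theorem groundEnergy_mul_le {s : ℝ} {k N : ℕ} (Ω : Set (Pos d)) {Ψ : WaveFn d (Fin N)}
    (h : Ψ ∈ vanishingSpace d (Fin N) s k) :
    groundEnergy s k N Ω * ∫⁻ x in {x : Config d (Fin N) | ∀ l, x l ∈ Ω}, ‖Ψ x‖ₑ ^ 2 ≤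
      fullyLocalEnergy s Ω Ψ := by
  set I := ∫⁻ x in {x : Config d (Fin N) | ∀ l, x l ∈ Ω}, ‖Ψ x‖ₑ ^ 2 with hI
  have hI1 : I ≠ ⊤ := by
    refine ne_top_of_le_ne_top ?_ (setLIntegral_le_lintegral _ _)
    rw [← enorm_sq_eq_lintegral]
    finiteness
  -- With no mass on `Ω^N` there is nothing to show; otherwise division by the square root of the
  -- mass gives an admissible competitor.
  rcases eq_or_ne I 0 with h0 | h0
  · rw [h0, mul_zero]; exact zero_le
  have hpos : 0 < I.toReal := ENNReal.toReal_pos h0 hI1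
  set c : ℂ := (((Real.sqrt I.toReal)⁻¹ : ℝ) : ℂ) with hc
  have hc0 : c ≠ 0 := by
    rw [hc]
    exact_mod_cast (inv_ne_zero (Real.sqrt_pos.2 hpos).ne')
  have hcI : ‖c‖ₑ ^ 2 * I = 1 := by
    rw [← ofReal_norm, hc, Complex.norm_real, Real.norm_of_nonneg (by positivity),
      ← ENNReal.ofReal_pow (by positivity), inv_pow, Real.sq_sqrt hpos.le,
      ← ENNReal.ofReal_toReal hI1, ENNReal.toReal_ofReal hpos.le,
      ← ENNReal.ofReal_mul (by positivity), inv_mul_cancel₀ hpos.ne', ENNReal.ofReal_one]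
  have hnorm : ∫⁻ x in {x : Config d (Fin N) | ∀ l, x l ∈ Ω}, ‖(c • Ψ) x‖ₑ ^ 2 = 1 := by
    rw [← hcI, hI, ← lintegral_const_mul' _ _ (by finiteness)]
    refine lintegral_congr_ae (ae_restrict_of_ae ?_)
    filter_upwards [Lp.coeFn_smul c Ψ] with x hx
    rw [hx, Pi.smul_apply, enorm_smul, mul_pow]
  have h1 : groundEnergy s k N Ω ≤ ‖c‖ₑ ^ 2 * fullyLocalEnergy s Ω Ψ := by
    refine (iInf_le_of_le (c • Ψ) (iInf₂_le (smul_mem_vanishingSpace h hc0) hnorm)).trans ?_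
    refine (fullyLocalEnergy_congr s Ω (Lp.coeFn_smul c Ψ)).le.trans ?_
    exact fullyLocalEnergy_const_mul_le s Ω Ψ hc0
  calc groundEnergy s k N Ω * I ≤ ‖c‖ₑ ^ 2 * fullyLocalEnergy s Ω Ψ * I := by gcongr
    _ = (‖c‖ₑ ^ 2 * I) * fullyLocalEnergy s Ω Ψ := by ring
    _ = fullyLocalEnergy s Ω Ψ := by rw [hcI, one_mul]

/-- Positions of the particles in `C ≃ A ⊕ B` from positions of the two groups. -/
def glueEquiv (d : ℕ) {A B C : Type*} (e : A ⊕ B ≃ C) :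
    (A → Pos d) × (B → Pos d) ≃ᵐ (C → Pos d) :=
  (MeasurableEquiv.sumPiEquivProdPi fun _ : A ⊕ B => Pos d).symm.trans
    (MeasurableEquiv.piCongrLeft (fun _ : C => Pos d) e)

theorem glueEquiv_apply {A B C : Type*} (e : A ⊕ B ≃ C) (p : (A → Pos d) × (B → Pos d))
    (t : A ⊕ B) : glueEquiv d e p (e t) = Sum.elim p.1 p.2 t := by
  change MeasurableEquiv.piCongrLeft (fun _ : C => Pos d) e
    ((MeasurableEquiv.sumPiEquivProdPi fun _ : A ⊕ B => Pos d).symm p) (e t) = _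
  rw [MeasurableEquiv.coe_piCongrLeft, Equiv.piCongrLeft_apply_apply]
  cases t <;> rfl

theorem volume_preserving_glueEquiv {A B C : Type*} [Fintype A] [Fintype B] [Fintype C]
    (e : A ⊕ B ≃ C) : MeasurePreserving (glueEquiv d e) :=
  (volume_measurePreserving_piCongrLeft (fun _ : C => Pos d) e).comp
    (volume_measurePreserving_sumPiEquivProdPi_symm fun _ : A ⊕ B => Pos d)

/-- Removing the particle `b` from the first group. -/
noncomputable def removeEquiv (e : ν ⊕ κ ≃ ι) (b : ν) :
    {b' : ν // b' ≠ b} ⊕ κ ≃ {l : ι // l ≠ e (Sum.inl b)} :=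
  Equiv.ofBijective
    (fun t => ⟨e (t.map Subtype.val id), fun h => by
      have h' := e.injective h
      rcases t with b' | c
      · exact b'.2 (Sum.inl_injective h')
      · exact Sum.inr_ne_inl h'⟩)
    ⟨fun t t' h => (Sum.map_injective.2 ⟨Subtype.val_injective, Function.injective_id⟩)
      (e.injective (congrArg Subtype.val h)), fun ⟨l, hl⟩ => by
      obtain ⟨t, rfl⟩ := e.surjective l
      rcases t with b' | c
      · exact ⟨Sum.inl ⟨b', fun h => hl (by rw [h])⟩, rfl⟩
      · exact ⟨Sum.inr c, rfl⟩⟩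

theorem insertAt_glueEquiv (e : ν ⊕ κ ≃ ι) (b : ν) (y : Pos d) (x : {b' : ν // b' ≠ b} → Pos d)
    (z : Config d κ) :
    insertAt (e (Sum.inl b)) y (glueEquiv d (removeEquiv e b) (x, z)) =
      join (glue d ν κ ι e) (insertAt b y x) z := by
  ext l : 1
  obtain ⟨t, rfl⟩ := e.surjective l
  rcases t with b' | c
  · rw [join_glue_inl]
    by_cases h : b' = b
    · subst h
      rw [insertAt_same, insertAt_same]
    · have hne : e (Sum.inl b') ≠ e (Sum.inl b) := fun h' => h (Sum.inl_injective (e.injective h'))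
      rw [insertAt_of_ne _ _ _ h, insertAt_of_ne _ _ _ hne]
      exact glueEquiv_apply (removeEquiv e b) (x, z) (Sum.inl ⟨b', h⟩)
  · rw [join_glue_inr]
    have hne : e (Sum.inr c) ≠ e (Sum.inl b) := fun h => Sum.inr_ne_inl (e.injective h)
    rw [insertAt_of_ne _ _ _ hne]
    exact glueEquiv_apply (removeEquiv e b) (x, z) (Sum.inr c)

theorem insertAt_affine (b : ν) (a : Pos d) (r : ℝ) (y : Pos d) (x : {b' : ν // b' ≠ b} → Pos d) :
    constConfig ν a + r • insertAt b y x = insertAt b (a + r • y) (fun l => a + r • x l) := by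
  ext l : 1
  by_cases h : l = b
  · subst h
    rw [PiLp.add_apply, PiLp.smul_apply, insertAt_same, insertAt_same]
    rfl
  · rw [PiLp.add_apply, PiLp.smul_apply, insertAt_of_ne _ _ _ h, insertAt_of_ne _ _ _ h]
    rfl

theorem measurableSet_forall_mem {ι : Type*} [Finite ι] {Q : Set (Pos d)} (hQ : MeasurableSet Q) :
    MeasurableSet {x : ι → Pos d | ∀ l, x l ∈ Q} := by
  rw [Set.ofPred_forall]
  exact MeasurableSet.iInter fun l => (measurable_pi_apply l) hQ

theorem setLIntegral_pi_affine {A : Type*} [Fintype A] {Q : Set (Pos d)} (hQ : MeasurableSet Q)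
    (f : (A → Pos d) → ℝ≥0∞) (a : Pos d) {r : ℝ} (hr : 0 < r) :
    ∫⁻ x in {x : A → Pos d | ∀ l, x l ∈ (fun y => a + r • y) ⁻¹' Q}, f (fun l => a + r • x l) =
      ENNReal.ofReal ((r ^ (Fintype.card A * d))⁻¹) *
        ∫⁻ x in {x : A → Pos d | ∀ l, x l ∈ Q}, f x := by
  have h1 := lintegral_comp_affine volume
    ({x : A → Pos d | ∀ l, x l ∈ Q}.indicator f) (fun _ => a) hr
  rw [Module.finrank_pi_fintype] at h1
  simp only [finrank_euclideanSpace_fin, Finset.sum_const, Finset.card_univ, smul_eq_mul] at h1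
  rw [← lintegral_indicator (measurableSet_forall_mem hQ), ← h1,
    ← lintegral_indicator (measurableSet_forall_mem (hQ.preimage (by fun_prop)))]
  rfl

theorem setLIntegral_config (S : Set (ι → Pos d)) (f : Config d ι → ℝ≥0∞) :
    ∫⁻ x in {x : Config d ι | x.ofLp ∈ S}, f x = ∫⁻ x in S, f (WithLp.toLp 2 x) :=
  (volume_preserving_toLp_config.setLIntegral_comp_preimage_emb
    (MeasurableEquiv.toLp 2 (ι → Pos d)).measurableEmbedding f
      {x : Config d ι | x.ofLp ∈ S}).symm

/-- The energy inequality for the particles in one group, with the others fixed. -/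
theorem ae_groundEnergy_mul_slice_le {N : ℕ} (e : Fin N ⊕ κ ≃ ι) {s : ℝ} (hs0 : 0 ≤ s) {k : ℕ}
    {Ψ : WaveFn d ι} (h : Ψ ∈ vanishingSpace d ι s k) (a : Pos d) {r : ℝ} (hr : 0 < r)
    {Q : Set (Pos d)} (hQ : MeasurableSet Q) :
    ∀ᵐ z : Config d κ, groundEnergy s k N ((fun x => a + r • x) ⁻¹' Q) *
        ∫⁻ x in {x : Config d (Fin N) | ∀ l, x l ∈ Q}, ‖Ψ (join (glue d (Fin N) κ ι e) x z)‖ₑ ^ 2 ≤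
      ENNReal.ofReal (r ^ (2 * s)) * ∑ b : Fin N,
        ∫⁻ x in {x : {b' : Fin N // b' ≠ b} → Pos d | ∀ l, x l ∈ Q},
          neumannSq s Q fun y => Ψ (insertAt (e (Sum.inl b)) y
            (glueEquiv d (removeEquiv e b) (x, z))) := by
  filter_upwards [ae_slice_mem_vanishingSpace e hs0 h a hr] with z hz
  obtain ⟨w, hw, hwe⟩ := hz
  set Q₀ := (fun x => a + r • x) ⁻¹' Q with hQ₀
  have h1 := groundEnergy_mul_le Q₀ hw
  rw [fullyLocalEnergy_congr s Q₀ hwe] at h1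
  set I := ∫⁻ x in {x : Config d (Fin N) | ∀ l, x l ∈ Q},
    ‖Ψ (join (glue d (Fin N) κ ι e) x z)‖ₑ ^ 2 with hI
  have e1 : ∫⁻ x in {x : Config d (Fin N) | ∀ l, x l ∈ Q₀}, ‖w x‖ₑ ^ 2 =
      ENNReal.ofReal ((r ^ (N * d))⁻¹) * I := by
    rw [lintegral_congr_ae (ae_restrict_of_ae (hwe.mono fun x hx => by rw [hx]))]
    have e2 := setLIntegral_pi_affine (A := Fin N) hQ (fun x =>
      ‖Ψ (join (glue d (Fin N) κ ι e) (WithLp.toLp 2 x) z)‖ₑ ^ 2) a hr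
    rw [Fintype.card_fin] at e2
    rw [hI]
    refine (setLIntegral_config {x | ∀ l, x l ∈ Q₀} _).trans (e2.trans ?_)
    congr 1
    exact (setLIntegral_config {x | ∀ l, x l ∈ Q} (fun x =>
      ‖Ψ (join (glue d (Fin N) κ ι e) x z)‖ₑ ^ 2)).symm
  rw [e1] at h1
  -- The `N - 1` spectators scale by `r^{-(N-1)d}` and the active particle by `r^{2s-d}`. The common
  -- factor `r^{-Nd}` also occurs in the mass and cancels, leaving `r^{2s}`.
  have h2 : fullyLocalEnergy s Q₀ (slice (glue d (Fin N) κ ι e) (constConfig (Fin N) a) r Ψ z) ≤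
      ENNReal.ofReal ((r ^ (N * d))⁻¹) * (ENNReal.ofReal (r ^ (2 * s)) * ∑ b : Fin N,
        ∫⁻ x in {x : {b' : Fin N // b' ≠ b} → Pos d | ∀ l, x l ∈ Q},
          neumannSq s Q fun y => Ψ (insertAt (e (Sum.inl b)) y
            (glueEquiv d (removeEquiv e b) (x, z)))) := by
    rw [fullyLocalEnergy, Finset.mul_sum, Finset.mul_sum]
    refine Finset.sum_le_sum fun b _ => ?_
    set F : ({b' : Fin N // b' ≠ b} → Pos d) → ℝ≥0∞ := fun x =>
      neumannSq s Q fun y => Ψ (insertAt (e (Sum.inl b)) y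
            (glueEquiv d (removeEquiv e b) (x, z))) with hF
    have e3 : ∀ x : {b' : Fin N // b' ≠ b} → Pos d, neumannSq s Q₀ (fun y =>
        slice (glue d (Fin N) κ ι e) (constConfig (Fin N) a) r Ψ z (insertAt b y x)) ≤
        ENNReal.ofReal (r ^ (2 * s - d)) * F (fun l => a + r • x l) := fun x => by
      have := neumannSq_comp_affine_le s a hr hQ fun y => Ψ (insertAt (e (Sum.inl b)) y
            (glueEquiv d (removeEquiv e b) (fun l => a + r • x l, z)))
      refine le_trans (le_of_eq ?_) this
      congr 1
      funext y
      rw [insertAt_glueEquiv, slice, insertAt_affine]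
    refine (lintegral_mono e3).trans ?_
    rw [lintegral_const_mul' _ _ (by simp), setLIntegral_pi_affine hQ F a hr, ← mul_assoc,
      ← mul_assoc, ← ENNReal.ofReal_mul (by positivity), ← ENNReal.ofReal_mul (by positivity)]
    refine le_of_eq (congrArg (fun t => ENNReal.ofReal t * _) ?_)
    have hcard : Fintype.card {b' : Fin N // b' ≠ b} + 1 = N := by
      have := b.pos
      rw [Fintype.card_subtype_compl, Fintype.card_fin, Fintype.card_subtype_eq]
      omega
    have hpow : r ^ (N * d) = r ^ (Fintype.card {b' : Fin N // b' ≠ b} * d) * r ^ d := by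
      rw [← pow_add, ← Nat.succ_mul, Nat.succ_eq_add_one, hcard]
    rw [hpow, Real.rpow_sub hr, Real.rpow_natCast, mul_inv, div_eq_mul_inv]
    ring
  have hc0 : ENNReal.ofReal ((r ^ (N * d))⁻¹) ≠ 0 := by
    have : 0 < (r ^ (N * d))⁻¹ := by positivity
    simpa using this
  rw [mul_left_comm] at h1
  exact (ENNReal.mul_le_mul_iff_right hc0 (by simp)).1 (h1.trans h2)

end LocalEnergy

/-! ### Counting disjoint blocks. -/

/-- Blocks of size `n` are removed one at a time; the remainder of fewer than `n` elements is
dropped. -/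
theorem div_card_mul_le_sum {ι : Type*} [DecidableEq ι] {n : ℕ} (hn : 0 < n) (f : ι → ℝ≥0∞)
    (t : ℝ≥0∞) (A : Finset ι) (h : ∀ B ⊆ A, B.card = n → t ≤ ∑ j ∈ B, f j) :
    ((A.card / n : ℕ) : ℝ≥0∞) * t ≤ ∑ j ∈ A, f j := by
  induction A using Finset.strongInduction with
  | H A ih =>
    rcases lt_or_ge A.card n with hlt | hle
    · simp [Nat.div_eq_of_lt hlt]
    · obtain ⟨B, hBA, hB⟩ := Finset.exists_subset_card_eq hle
      have hne : B.Nonempty := Finset.card_pos.1 (hB ▸ hn)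
      have h1 := ih (A \ B) (Finset.sdiff_ssubset hBA hne) fun C hC =>
        h C (hC.trans Finset.sdiff_subset)
      rw [Finset.card_sdiff_of_subset hBA, hB] at h1
      rw [Nat.div_eq_sub_div hn hle, Nat.cast_add, add_mul, Nat.cast_one, one_mul,
        ← Finset.sum_sdiff hBA]
      exact add_le_add h1 (h B hBA hB)

/-- At least one block exists, so the remainder costs no more than a factor two: `|A| < n⌊|A|/n⌋ + n
≤ 2n⌊|A|/n⌋`. The bound becomes linear in `|A|`, as the density requires. -/
theorem card_mul_le_sum {ι : Type*} [DecidableEq ι] {n : ℕ} (hn : 0 < n) (f : ι → ℝ≥0∞)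
    (t : ℝ≥0∞) {A : Finset ι} (hA : n ≤ A.card) (h : ∀ B ⊆ A, B.card = n → t ≤ ∑ j ∈ B, f j) :
    (A.card : ℝ≥0∞) * t ≤ ((2 * n : ℕ) : ℝ≥0∞) * ∑ j ∈ A, f j := by
  have h1 : A.card ≤ 2 * n * (A.card / n) := by
    have h2 := Nat.div_add_mod A.card n
    have h3 := Nat.mod_lt A.card hn
    have h4 : 1 ≤ A.card / n := (Nat.one_le_div_iff hn).2 hA
    nlinarith
  calc (A.card : ℝ≥0∞) * t ≤ ((2 * n * (A.card / n) : ℕ) : ℝ≥0∞) * t := by gcongr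
    _ = ((2 * n : ℕ) : ℝ≥0∞) * (((A.card / n : ℕ) : ℝ≥0∞) * t) := by
      rw [Nat.cast_mul, mul_assoc]
    _ ≤ _ := by
      gcongr
      exact div_card_mul_le_sum hn f t A h

/-! ### Decomposition by the set of particles inside the cube. -/

section Patterns

variable {d : ℕ} {ι κ : Type*} [Fintype ι] [Fintype κ] [DecidableEq ι] [DecidableEq κ]

theorem measurableSet_forall_mem_iff {τ : Type*} [Finite τ] {Q : Set (Pos d)}
    (hQ : MeasurableSet Q) (p : τ → Prop) :
    MeasurableSet {x : τ → Pos d | ∀ l, x l ∈ Q ↔ p l} := by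
  rw [Set.ofPred_forall]
  refine MeasurableSet.iInter fun l => ?_
  by_cases h : p l
  · simp only [h, iff_true]
    exact (measurable_pi_apply l) hQ
  · simp only [h, iff_false]
    exact ((measurable_pi_apply l) hQ).compl

theorem measurable_ofLp_config {τ : Type*} [Fintype τ] :
    Measurable (WithLp.ofLp : Config d τ → τ → Pos d) :=
  (MeasurableEquiv.toLp 2 (τ → Pos d)).symm.measurable

theorem aemeasurable_neumannSq_insertAt {s : ℝ} (hs0 : 0 ≤ s) {k : ℕ} {Ψ : WaveFn d ι}
    (h : Ψ ∈ vanishingSpace d ι s k) (Q : Set (Pos d)) (j : ι) :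
    AEMeasurable fun x' : {l : ι // l ≠ j} → Pos d =>
      neumannSq s Q fun y => Ψ (insertAt j y x') := by
  obtain ⟨φ, Φ, h1, h2, h3, h4, h5⟩ := exists_fast_approximation h
  have := aemeasurable_neumannSq_slice (insertEquiv d ι j) hs0 Q h1 h2 h4 h5
  simp only [slice_insertEquiv] at this
  exact this.comp_quasiMeasurePreserving
    volume_preserving_toLp_config.quasiMeasurePreserving

/-- Only the particles in a set `A` are in `Q`: the energy of the particles in a subset of `A`. -/
theorem groundEnergy_mul_pattern_le {N : ℕ} (e : Fin N ⊕ κ ≃ ι) {s : ℝ} (hs0 : 0 ≤ s) {k : ℕ}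
    {Ψ : WaveFn d ι} (h : Ψ ∈ vanishingSpace d ι s k) (a : Pos d) {r : ℝ} (hr : 0 < r)
    {Q : Set (Pos d)} (hQ : MeasurableSet Q) {A : Finset ι} (hA : ∀ b, e (Sum.inl b) ∈ A) :
    groundEnergy s k N ((fun x => a + r • x) ⁻¹' Q) *
        ∫⁻ v in {v : Config d ι | ∀ l, v l ∈ Q ↔ l ∈ A}, ‖Ψ v‖ₑ ^ 2 ≤
      ENNReal.ofReal (r ^ (2 * s)) * ∑ b : Fin N,
        ∫⁻ x' in {x' : {l : ι // l ≠ e (Sum.inl b)} → Pos d | ∀ l, x' l ∈ Q ↔ l.1 ∈ A},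
          neumannSq s Q fun y => Ψ (insertAt (e (Sum.inl b)) y x') := by
  set R : Set (κ → Pos d) := {z | ∀ c, z c ∈ Q ↔ e (Sum.inr c) ∈ A} with hR
  have hRm : MeasurableSet R := measurableSet_forall_mem_iff hQ _
  have hPm : MeasurableSet {v : Config d ι | ∀ l, v l ∈ Q ↔ l ∈ A} :=
    measurable_ofLp_config (measurableSet_forall_mem_iff hQ fun l => l ∈ A)
  have hQNm : MeasurableSet {x : Config d (Fin N) | ∀ l, x l ∈ Q} :=
    measurable_ofLp_config (measurableSet_forall_mem hQ)
  have hΨm : Measurable fun v => ‖Ψ v‖ₑ ^ 2 :=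
    (Lp.stronglyMeasurable Ψ).measurable.enorm.pow_const 2
  -- The block lies inside `A`, so the pattern is a product: all block particles in `Q`, and the
  -- condition `R` on the others.
  have e1 : ∫⁻ v in {v : Config d ι | ∀ l, v l ∈ Q ↔ l ∈ A}, ‖Ψ v‖ₑ ^ 2 =
      ∫⁻ z in {z : Config d κ | z.ofLp ∈ R}, ∫⁻ x in {x : Config d (Fin N) | ∀ l, x l ∈ Q},
        ‖Ψ (join (glue d (Fin N) κ ι e) x z)‖ₑ ^ 2 := by
    rw [← lintegral_indicator hPm, lintegral_join (glue d (Fin N) κ ι e)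
      (hΨm.indicator hPm).aemeasurable, ← lintegral_indicator
        (show MeasurableSet {z : Config d κ | z.ofLp ∈ R} from measurable_ofLp_config hRm)]
    refine lintegral_congr fun z => ?_
    by_cases hz : z.ofLp ∈ R
    · rw [Set.indicator_of_mem (show z ∈ {z : Config d κ | z.ofLp ∈ R} from hz),
        ← lintegral_indicator hQNm]
      refine lintegral_congr fun x => ?_
      have : join (glue d (Fin N) κ ι e) x z ∈ {v : Config d ι | ∀ l, v l ∈ Q ↔ l ∈ A} ↔
          x ∈ {x : Config d (Fin N) | ∀ l, x l ∈ Q} := by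
        refine ⟨fun hx b => ?_, fun hx l => ?_⟩
        · have := (hx (e (Sum.inl b))).2 (hA b)
          rwa [join_glue_inl] at this
        · obtain ⟨t, rfl⟩ := e.surjective l
          rcases t with b | c
          · rw [join_glue_inl]
            exact iff_of_true (hx b) (hA b)
          · rw [join_glue_inr]
            exact hz c
      by_cases hx : x ∈ {x : Config d (Fin N) | ∀ l, x l ∈ Q}
      · rw [Set.indicator_of_mem hx, Set.indicator_of_mem (this.2 hx)]
      · rw [Set.indicator_of_notMem hx, Set.indicator_of_notMem fun h' => hx (this.1 h')]
    · rw [Set.indicator_of_notMem (show z ∉ {z : Config d κ | z.ofLp ∈ R} from hz)]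
      refine (lintegral_congr fun x => ?_).trans lintegral_zero
      refine Set.indicator_of_notMem (fun hx => hz fun c => ?_) _
      have := hx (e (Sum.inr c))
      rwa [join_glue_inr] at this
  have hF : ∀ b : Fin N, AEMeasurable (fun p : ({b' : Fin N // b' ≠ b} → Pos d) × (κ → Pos d) =>
      neumannSq s Q fun y => Ψ (insertAt (e (Sum.inl b)) y
        (glueEquiv d (removeEquiv e b) p))) (volume.prod volume) := fun b =>
    (aemeasurable_neumannSq_insertAt hs0 h Q (e (Sum.inl b))).comp_quasiMeasurePreserving
      (volume_preserving_glueEquiv (removeEquiv e b)).quasiMeasurePreserving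
  have hFr : ∀ b : Fin N, AEMeasurable (fun p : ({b' : Fin N // b' ≠ b} → Pos d) × (κ → Pos d) =>
      neumannSq s Q fun y => Ψ (insertAt (e (Sum.inl b)) y
        (glueEquiv d (removeEquiv e b) p)))
      ((volume.restrict {x | ∀ l, x l ∈ Q}).prod (volume.restrict R)) := fun b => by
    rw [Measure.prod_restrict]
    exact (hF b).restrict
  -- The same factorization for the energy of one block particle, whose own position is unrestricted
  -- in `x'`; Tonelli needs the measurability `hFr`.
  have e2 : ∀ b : Fin N,
      ∫⁻ z in R, ∫⁻ x in {x : {b' : Fin N // b' ≠ b} → Pos d | ∀ l, x l ∈ Q},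
          (neumannSq s Q fun y => Ψ (insertAt (e (Sum.inl b)) y
            (glueEquiv d (removeEquiv e b) (x, z)))) =
        ∫⁻ x' in {x' : {l : ι // l ≠ e (Sum.inl b)} → Pos d | ∀ l, x' l ∈ Q ↔ l.1 ∈ A},
          neumannSq s Q fun y => Ψ (insertAt (e (Sum.inl b)) y x') := fun b => by
    rw [← (volume_preserving_glueEquiv (d := d) (removeEquiv e b)).setLIntegral_comp_preimage_emb
      (glueEquiv d (removeEquiv e b)).measurableEmbedding, ← lintegral_prod_symm _ (hFr b),
      Measure.prod_restrict]
    refine setLIntegral_congr (Filter.EventuallyEq.of_eq ?_)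
    ext p
    refine ⟨fun hp l => ?_, fun hp => ⟨fun b' => ?_, fun c => ?_⟩⟩
    · obtain ⟨t, rfl⟩ := (removeEquiv e b).surjective l
      rw [glueEquiv_apply]
      rcases t with b' | c
      · exact iff_of_true (hp.1 b') (hA b'.1)
      · exact hp.2 c
    · have := hp (removeEquiv e b (Sum.inl b'))
      rw [glueEquiv_apply] at this
      exact this.2 (hA b'.1)
    · have := hp (removeEquiv e b (Sum.inr c))
      rwa [glueEquiv_apply] at this
  rw [e1]
  refine (lintegral_const_mul_le _ _).trans ((lintegral_mono_ae (ae_restrict_of_ae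
    (ae_groundEnergy_mul_slice_le e hs0 h a hr hQ))).trans (le_of_eq ?_))
  rw [lintegral_const_mul' _ _ (by simp)]
  congr 1
  refine (setLIntegral_config R fun z : Config d κ => ∑ b : Fin N,
        ∫⁻ x in {x : {b' : Fin N // b' ≠ b} → Pos d | ∀ l, x l ∈ Q},
          neumannSq s Q fun y => Ψ (insertAt (e (Sum.inl b)) y
            (glueEquiv d (removeEquiv e b) (x, z)))).trans ?_
  rw [lintegral_finsetSum' _ fun b _ => ?_]
  · exact Finset.sum_congr rfl fun b _ => e2 b
  · exact (hFr b).prod_swap.lintegral_prod_right'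

theorem sum_pattern_eq (Ψ : WaveFn d ι) {Q : Set (Pos d)} (hQ : MeasurableSet Q) :
    ∑ A : Finset ι, ∫⁻ v in {v : Config d ι | ∀ l, v l ∈ Q ↔ l ∈ A}, ‖Ψ v‖ₑ ^ 2 =
      ∫⁻ v, ‖Ψ v‖ₑ ^ 2 := by
  classical
  rw [← lintegral_biUnion_finset]
  · have : (⋃ A ∈ (Finset.univ : Finset (Finset ι)),
        {v : Config d ι | ∀ l, v l ∈ Q ↔ l ∈ A}) = Set.univ :=
      Set.eq_univ_of_forall fun v => Set.mem_iUnion₂.2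
        ⟨Finset.univ.filter fun l => v l ∈ Q, Finset.mem_univ _, fun l => by simp⟩
    rw [this, setLIntegral_univ]
  · intro A _ B _ hAB
    refine Set.disjoint_left.2 fun v hv hv' => hAB (Finset.ext fun l => ?_)
    exact (hv l).symm.trans (hv' l)
  · exact fun A _ => measurable_ofLp_config
      (measurableSet_forall_mem_iff hQ fun l => l ∈ A)

/-- Tonelli turns the term of particle `j` into the mass on `x_j ∈ Q`. A pattern `A` lies in this
set exactly when `j ∈ A`, so it is counted `|A|` times. -/
theorem setLIntegral_density (Ψ : WaveFn d ι) {Q : Set (Pos d)} (hQ : MeasurableSet Q) :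
    ∫⁻ x in Q, density Ψ x = ∑ A : Finset ι,
      (A.card : ℝ≥0∞) * ∫⁻ v in {v : Config d ι | ∀ l, v l ∈ Q ↔ l ∈ A}, ‖Ψ v‖ₑ ^ 2 := by
  classical
  have hΨm : Measurable fun v => ‖Ψ v‖ₑ ^ 2 :=
    (Lp.stronglyMeasurable Ψ).measurable.enorm.pow_const 2
  have hjm : ∀ j : ι, Measurable fun p : Pos d × ({l : ι // l ≠ j} → Pos d) =>
      ‖Ψ (insertAt j p.1 p.2)‖ₑ ^ 2 := fun j =>
    hΨm.comp ((continuous_join (insertEquiv d ι j)).measurable.comp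
      (f := fun p : Pos d × ({l : ι // l ≠ j} → Pos d) => (p.1, WithLp.toLp 2 p.2))
      (measurable_fst.prodMk
        ((MeasurableEquiv.toLp 2 ({l : ι // l ≠ j} → Pos d)).measurable.comp measurable_snd)))
  have h1 : ∀ j : ι, ∫⁻ x in Q, ∫⁻ x' : {l : ι // l ≠ j} → Pos d, ‖Ψ (insertAt j x x')‖ₑ ^ 2 =
      ∫⁻ v in {v : Config d ι | v j ∈ Q}, ‖Ψ v‖ₑ ^ 2 := fun j => by
    have hm : MeasurableSet {v : Config d ι | v j ∈ Q} :=
      measurable_ofLp_config (measurable_pi_apply j hQ)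
    rw [← lintegral_indicator hm, lintegral_join (insertEquiv d ι j)
      (hΨm.indicator hm).aemeasurable, lintegral_lintegral_swap (hjm j).aemeasurable,
      ← lintegral_config]
    refine lintegral_congr fun z => ?_
    rw [← lintegral_indicator hQ]
    refine lintegral_congr fun y => ?_
    rw [join_insertEquiv]
    by_cases hy : y ∈ Q
    · rw [Set.indicator_of_mem hy, Set.indicator_of_mem]
      change insertAt j y z j ∈ Q
      rwa [insertAt_same]
    · rw [Set.indicator_of_notMem hy, Set.indicator_of_notMem]
      change insertAt j y z j ∉ Q
      rwa [insertAt_same]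
  have h2 : ∀ j : ι, ∫⁻ v in {v : Config d ι | v j ∈ Q}, ‖Ψ v‖ₑ ^ 2 =
      ∑ A : Finset ι with j ∈ A,
        ∫⁻ v in {v : Config d ι | ∀ l, v l ∈ Q ↔ l ∈ A}, ‖Ψ v‖ₑ ^ 2 := fun j => by
    rw [← lintegral_biUnion_finset]
    · congr 2
      ext v
      simp only [Set.mem_iUnion₂, Finset.mem_filter, Finset.mem_univ, true_and, exists_prop]
      refine ⟨fun hv => ⟨Finset.univ.filter fun l => v l ∈ Q, by simpa using hv,
        fun l => by simp⟩, fun ⟨A, hjA, hv⟩ => (hv j).2 hjA⟩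
    · intro A _ B _ hAB
      refine Set.disjoint_left.2 fun v hv hv' => hAB (Finset.ext fun l => ?_)
      exact (hv l).symm.trans (hv' l)
    · exact fun A _ => measurable_ofLp_config (measurableSet_forall_mem_iff hQ fun l => l ∈ A)
  unfold density
  rw [lintegral_finsetSum _ fun j _ => (hjm j).lintegral_prod_right']
  simp only [h1, h2, Finset.sum_filter]
  rw [Finset.sum_comm]
  refine Finset.sum_congr rfl fun A _ => ?_
  rw [Finset.sum_ite_mem, Finset.univ_inter, Finset.sum_const, nsmul_eq_mul]

/-- For a fixed `j`, patterns containing `j` are told apart by the other particles, so they give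
disjoint sets of `x'`. -/
theorem sum_pattern_le_localEnergy (s : ℝ) (Ψ : Config d ι → ℂ) {Q : Set (Pos d)}
    (hQ : MeasurableSet Q) :
    (∑ A : Finset ι, ∑ j ∈ A,
        ∫⁻ x' in {x' : {l : ι // l ≠ j} → Pos d | ∀ l, x' l ∈ Q ↔ l.1 ∈ A},
          (neumannSq s Q fun y => Ψ (insertAt j y x'))) ≤ localEnergy s Q Ψ := by
  classical
  have e : ∀ A : Finset ι, ∑ j ∈ A,
      ∫⁻ x' in {x' : {l : ι // l ≠ j} → Pos d | ∀ l, x' l ∈ Q ↔ l.1 ∈ A},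
          (neumannSq s Q fun y => Ψ (insertAt j y x')) =
      ∑ j, if j ∈ A then
        ∫⁻ x' in {x' : {l : ι // l ≠ j} → Pos d | ∀ l, x' l ∈ Q ↔ l.1 ∈ A},
          (neumannSq s Q fun y => Ψ (insertAt j y x')) else 0 := fun A => by
    rw [Finset.sum_ite_mem, Finset.univ_inter]
  simp only [e]
  rw [Finset.sum_comm]
  refine Finset.sum_le_sum fun j _ => ?_
  rw [← Finset.sum_filter, ← lintegral_biUnion_finset]
  · exact setLIntegral_le_lintegral _ _
  · intro A hA B hB hAB
    refine Set.disjoint_left.2 fun v hv hv' => hAB (Finset.ext fun l => ?_)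
    by_cases hl : l = j
    · subst hl
      exact iff_of_true (Finset.mem_filter.1 hA).2 (Finset.mem_filter.1 hB).2
    · exact (hv ⟨l, hl⟩).symm.trans (hv' ⟨l, hl⟩)
  · exact fun A _ =>
      measurableSet_forall_mem_iff hQ fun l : {l : ι // l ≠ j} => l.1 ∈ A

/-- The local exclusion bound on the image of `Ω` under `x ↦ a + r x` from the positivity of the
ground-state energy on `Ω`. -/
theorem groundEnergy_mul_density_le {q : ℝ} (hq : 0 < q) {s : ℝ} (hs0 : 0 ≤ s) {k : ℕ}
    {Ψ : WaveFn d ι} (h : Ψ ∈ vanishingSpace d ι s k) (hΨ : ‖Ψ‖ = 1) (a : Pos d) {r : ℝ}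
    (hr : 0 < r) {Q : Set (Pos d)} (hQ : MeasurableSet Q) :
    groundEnergy s k ⌈q⌉₊ ((fun x => a + r • x) ⁻¹' Q) *
        ((∫⁻ x in Q, density Ψ x) - ENNReal.ofReal q) ≤
      ((2 * ⌈q⌉₊ : ℕ) : ℝ≥0∞) * (ENNReal.ofReal (r ^ (2 * s)) * localEnergy s Q Ψ) := by
  classical
  set n := ⌈q⌉₊ with hn
  have hn0 : 0 < n := Nat.ceil_pos.2 hq
  set G := groundEnergy s k n ((fun x => a + r • x) ⁻¹' Q) with hG
  set p : Finset ι → ℝ≥0∞ := fun A =>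
    ∫⁻ v in {v : Config d ι | ∀ l, v l ∈ Q ↔ l ∈ A}, ‖Ψ v‖ₑ ^ 2 with hp
  set E : Finset ι → ι → ℝ≥0∞ := fun A j =>
    ∫⁻ x' in {x' : {l : ι // l ≠ j} → Pos d | ∀ l, x' l ∈ Q ↔ l.1 ∈ A},
      neumannSq s Q fun y => Ψ (insertAt j y x') with hE
  have hsum : ∑ A, p A = 1 := by
    rw [hp, sum_pattern_eq Ψ hQ, ← enorm_sq_eq_lintegral, ← ofReal_norm, hΨ, ENNReal.ofReal_one,
      one_pow]
  -- Every `n`-element `B ⊆ A` may serve as the block, with its complement frozen; `card_mul_le_sum`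
  -- then combines disjoint blocks.
  have hblock : ∀ A : Finset ι, n ≤ A.card → (A.card : ℝ≥0∞) * (G * p A) ≤
      ((2 * n : ℕ) : ℝ≥0∞) * ∑ j ∈ A, ENNReal.ofReal (r ^ (2 * s)) * E A j := fun A hA => by
    refine card_mul_le_sum hn0 _ _ hA fun B hBA hB => ?_
    let eB : Fin n ≃ {l : ι // l ∈ B} := (B.equivFinOfCardEq hB).symm
    let e : Fin n ⊕ {l : ι // l ∉ B} ≃ ι :=
      (Equiv.sumCongr eB (Equiv.refl _)).trans (Equiv.sumCompl fun l => l ∈ B)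
    have he : ∀ b, e (Sum.inl b) = eB b := fun b => rfl
    have h1 := groundEnergy_mul_pattern_le e hs0 h a hr hQ (A := A) fun b => hBA (eB b).2
    refine h1.trans (le_of_eq ?_)
    rw [← Finset.mul_sum]
    congr 1
    rw [← Finset.sum_coe_sort B (E A)]
    exact Equiv.sum_comp eB fun l : {l : ι // l ∈ B} => E A l
  -- Since `n = ⌈q⌉₊`, a pattern with fewer than `n` particles has `|A| < q`; as the masses add up
  -- to one, all these patterns together contribute at most `q`.
  have hdens : (∫⁻ x in Q, density Ψ x) - ENNReal.ofReal q ≤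
      ∑ A : Finset ι with n ≤ A.card, (A.card : ℝ≥0∞) * p A := by
    rw [tsub_le_iff_right, setLIntegral_density Ψ hQ, ← mul_one (ENNReal.ofReal q), ← hsum,
      Finset.mul_sum, Finset.sum_filter, ← Finset.sum_add_distrib]
    refine Finset.sum_le_sum fun A _ => ?_
    split_ifs with hA
    · exact le_self_add
    · rw [zero_add]
      gcongr
      rw [← ENNReal.ofReal_natCast]
      exact ENNReal.ofReal_le_ofReal (Nat.lt_ceil.1 (not_le.1 hA)).le
  calc G * ((∫⁻ x in Q, density Ψ x) - ENNReal.ofReal q)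
      ≤ G * ∑ A : Finset ι with n ≤ A.card, (A.card : ℝ≥0∞) * p A := by gcongr
    _ = ∑ A : Finset ι with n ≤ A.card, (A.card : ℝ≥0∞) * (G * p A) := by
        rw [Finset.mul_sum]
        exact Finset.sum_congr rfl fun A _ => mul_left_comm _ _ _
    _ ≤ ∑ A : Finset ι with n ≤ A.card,
          ((2 * n : ℕ) : ℝ≥0∞) * ∑ j ∈ A, ENNReal.ofReal (r ^ (2 * s)) * E A j :=
        Finset.sum_le_sum fun A hA => hblock A (Finset.mem_filter.1 hA).2
    _ ≤ ∑ A : Finset ι,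
          ((2 * n : ℕ) : ℝ≥0∞) * ∑ j ∈ A, ENNReal.ofReal (r ^ (2 * s)) * E A j :=
        Finset.sum_le_sum_of_subset (Finset.filter_subset _ _)
    _ = ((2 * n : ℕ) : ℝ≥0∞) * (ENNReal.ofReal (r ^ (2 * s)) * ∑ A : Finset ι, ∑ j ∈ A, E A j) := by
        simp only [← Finset.mul_sum]
    _ ≤ _ := by
        gcongr
        exact sum_pattern_le_localEnergy s Ψ hQ

theorem localEnergy_congr_set (s : ℝ) {Ω Ω' : Set (Pos d)} (h : Ω =ᵐ[volume] Ω')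
    (Ψ : Config d ι → ℂ) : localEnergy s Ω Ψ = localEnergy s Ω' Ψ := by
  simp only [localEnergy, neumannSq_congr_set s h]

end Patterns

/-! ### Reduction of cubes to the closed unit cube. -/

section Cubes

variable {d : ℕ}

/-- The closed cube with corner `a` and side `l`. -/
def closedCube (a : Pos d) (l : ℝ) : Set (Pos d) := {x | ∀ i, a i ≤ x i ∧ x i ≤ a i + l}

theorem closedCube_eq_preimage (a : Pos d) (l : ℝ) :
    closedCube a l = WithLp.ofLp ⁻¹' Set.Icc a.ofLp (fun i => a i + l) := by
  ext x
  simp [closedCube, Pi.le_def, forall_and]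

theorem measurableSet_closedCube (a : Pos d) (l : ℝ) : MeasurableSet (closedCube a l) := by
  rw [closedCube_eq_preimage]
  exact (MeasurableEquiv.toLp 2 (Fin d → ℝ)).symm.measurable measurableSet_Icc

theorem volume_closedCube (a : Pos d) {l : ℝ} (hl : 0 < l) :
    volume (closedCube a l) = ENNReal.ofReal (l ^ d) := by
  rw [closedCube_eq_preimage, (PiLp.volume_preserving_ofLp (Fin d)).measure_preimage
    measurableSet_Icc.nullMeasurableSet, Real.volume_Icc_pi]
  simp [ENNReal.ofReal_pow hl.le]

/-- The boundary is a null set, so an arbitrary, possibly non-Borel choice of boundary points does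
not matter. -/
theorem ae_eq_closedCube {Q : Set (Pos d)} {a : Pos d} {l : ℝ}
    (h1 : {x : Pos d | ∀ i, a i < x i ∧ x i < a i + l} ⊆ Q) (h2 : Q ⊆ closedCube a l) :
    Q =ᵐ[volume] closedCube a l := by
  have h3 : {x : Pos d | ∀ i, a i < x i ∧ x i < a i + l} =ᵐ[volume] closedCube a l := by
    have := (PiLp.volume_preserving_ofLp (Fin d)).quasiMeasurePreserving.preimage_ae_eq
      (Measure.univ_pi_Ioo_ae_eq_Icc (μ := fun _ : Fin d => (volume : Measure ℝ))
        (f := a.ofLp) (g := fun i => a i + l))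
    rw [closedCube_eq_preimage]
    have h : {x : Pos d | ∀ i, a i < x i ∧ x i < a i + l} =
        WithLp.ofLp ⁻¹' Set.univ.pi fun i => Set.Ioo (a i) (a i + l) :=
      Set.ext fun x => by simp [Set.mem_pi]
    rw [h]
    exact this
  exact Filter.EventuallyLE.antisymm (LE.le.eventuallyLE h2)
    (h3.symm.le.trans (LE.le.eventuallyLE h1))

theorem preimage_closedCube (a : Pos d) {l : ℝ} (hl : 0 < l) :
    (fun x => a + l • x) ⁻¹' closedCube a l = closedCube 0 1 := by
  ext x
  simp only [closedCube, Set.mem_preimage, Set.mem_ofPred_eq, PiLp.add_apply, PiLp.smul_apply,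
    PiLp.zero_apply, smul_eq_mul, zero_add, le_add_iff_nonneg_right, add_le_add_iff_left]
  refine forall_congr' fun i => and_congr ?_ ?_
  · exact mul_nonneg_iff_of_pos_left hl
  · exact mul_le_iff_le_one_right hl

end Cubes

end ManyBody

/-! ### The local exclusion principle. -/

open ManyBody

theorem lemma6 (d k : ℕ) (hd : 1 ≤ d) (hk : 2 ≤ k) (s : ℝ) (hs : 0 < s) (q : ℝ) (hq : 0 < q)
    (hpos : ∀ Q : Set (ManyBody.Pos d), ManyBody.IsCube Q →
      ∀ N : ℕ, q ≤ (N : ℝ) → 0 < ManyBody.groundEnergy s k N Q) :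
    ∃ C : ℝ, 0 < C ∧
      ∀ N : ℕ, 1 ≤ N → ∀ Ψ : ManyBody.WaveFn d (Fin N),
        Ψ ∈ ManyBody.vanishingSpace d (Fin N) s k → ‖Ψ‖ = 1 →
        ∀ Q : Set (ManyBody.Pos d), ManyBody.IsCube Q →
          ENNReal.ofReal (C * (volume Q).toReal ^ (-(2 * s / (d : ℝ)))) *
              ((∫⁻ x in Q, ManyBody.density Ψ x) - ENNReal.ofReal q) ≤
            ManyBody.localEnergy s Q Ψ := by
  set G := groundEnergy s k ⌈q⌉₊ (closedCube (0 : Pos d) 1) with hG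
  have hGpos : 0 < G := hpos (closedCube 0 1) ⟨0, 1, one_pos,
    fun x hx i => ⟨(hx i).1.le, (hx i).2.le⟩, fun x hx => hx⟩ _ (Nat.le_ceil q)
  have hn0 : 0 < ⌈q⌉₊ := Nat.ceil_pos.2 hq
  have hn0' : (0 : ℝ) < ⌈q⌉₊ := by exact_mod_cast hn0
  -- The infimum `G` may be `⊤`; truncation at one yields a positive real constant.
  have hc : min G 1 ≠ ⊤ := ne_top_of_le_ne_top ENNReal.one_ne_top (min_le_right _ _)
  have hc0 : 0 < (min G 1).toReal := ENNReal.toReal_pos (lt_min hGpos one_pos).ne' hc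
  -- The denominator is the factor lost in block counting. `G` belongs to the unit cube, so the
  -- constant involves only `d`, `s`, `k` and `q`.
  refine ⟨(min G 1).toReal / (2 * ⌈q⌉₊), by positivity, fun N _ Ψ hΨ hnorm Q hQ => ?_⟩
  obtain ⟨a, l, hl, h1, h2⟩ := hQ
  have hae : Q =ᵐ[volume] closedCube a l := ae_eq_closedCube h1 h2
  rw [localEnergy_congr_set s hae, setLIntegral_congr hae, measure_congr hae,
    volume_closedCube a hl, ENNReal.toReal_ofReal (by positivity)]
  have hmain := groundEnergy_mul_density_le hq hs.le hΨ hnorm a hl (measurableSet_closedCube a l)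
  rw [preimage_closedCube a hl] at hmain
  have hpow : (l ^ d) ^ (-(2 * s / (d : ℝ))) = (l ^ (2 * s))⁻¹ := by
    have hd' : (d : ℝ) ≠ 0 := by positivity
    rw [← Real.rpow_natCast, ← Real.rpow_mul hl.le, ← Real.rpow_neg hl.le]
    congr 1
    field_simp
  set X := (∫⁻ x in closedCube a l, density Ψ x) - ENNReal.ofReal q with hX
  set K := 2 * (⌈q⌉₊ : ℝ) * l ^ (2 * s) with hK
  have hKpos : 0 < K := by positivity
  have hK2 : ((2 * ⌈q⌉₊ : ℕ) : ℝ≥0∞) * (ENNReal.ofReal (l ^ (2 * s)) *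
      localEnergy s (closedCube a l) Ψ) = ENNReal.ofReal K * localEnergy s (closedCube a l) Ψ := by
    rw [← mul_assoc, ← ENNReal.ofReal_natCast, ← ENNReal.ofReal_mul (by positivity), hK]
    push_cast
    rfl
  rw [hK2] at hmain
  have hC : ENNReal.ofReal ((min G 1).toReal / (2 * ⌈q⌉₊) * (l ^ d) ^ (-(2 * s / (d : ℝ)))) =
      ENNReal.ofReal K⁻¹ * min G 1 := by
    rw [hpow, ← ENNReal.ofReal_toReal hc, ENNReal.toReal_ofReal hc0.le,
      ← ENNReal.ofReal_mul (by positivity), hK]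
    congr 1
    field_simp
  rw [hC, mul_assoc]
  calc ENNReal.ofReal K⁻¹ * (min G 1 * X)
      ≤ ENNReal.ofReal K⁻¹ * (ENNReal.ofReal K * localEnergy s (closedCube a l) Ψ) := by
        exact mul_le_mul' le_rfl ((mul_le_mul' (min_le_left G 1) le_rfl).trans hmain)
    _ = localEnergy s (closedCube a l) Ψ := by
        rw [← mul_assoc, ← ENNReal.ofReal_mul (by positivity), inv_mul_cancel₀ hKpos.ne',
          ENNReal.ofReal_one, one_mul]
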